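/- **Theorem 4.1.** Let $m\ge 2$. The ExtendedHyperLogLog (EHLL) sketch consists of $m$ cells; cell $j$ stores a counter $C_1[j]\in\{0,1,2,\dots\}$, initially $0$, and a bit $C_2[j]\in\{0,1\}$, initially $1$. Every element $v$ of a stream is hashed to a pair $(j,\rho)$, where $j$ is uniform on $\{1,\dots,m\}$, $\rho$ is independent of $j$ with $\Pr(\rho=k)=2^{-k}$ for $k\ge1$, and the pairs of distinct elements are independent (equal elements have equal pairs). When an element with pair $(j,\rho)$ is processed, then * if $\rho=C_1[j]+1$, set $C_1[j]\leftarrow\rho$ and $C_2[j]\leftarrow1$; * else if $\rho>C_1[j]+1$, set $C_1[j]\leftarrow\rho$ and $C_2[j]\leftarrow0$; * else if $\rho=C_1[j]-1$ and $C_2[j]=0$, set $C_2[j]\leftarrow1$; * otherwise nothing changes. Let $$Y=\Bigl(\sum_{j=1}^m \bigl(2^{-C_1[j]}+(1-C_2[j])\,2^{-C_1[j]+1}\bigr)\Bigr)^{-1}.$$ Then, given the current sketch, $\frac1{mY}$ is the probability that the arrival of a new element (one that has not occurred in the stream) changes the sketch. After any stream, $Y$ is integrable, and for a nonempty stream its expectation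 depends on the stream only through the number $n$ of its distinct elements. Write $\mathbb E_n[Y]$ for this expectation. Further, with $$f(u)=\log_2\frac{2+u}{1+u}+\log_2\frac{4+3u}{3+3u}-\log_2\frac{4+u}{3+u},$$ the integral $\int_0^\infty f(u)^m\,du$ converges, and as $n\to\infty$ with $m$ fixed $$\mathbb E_n[Y]=\frac nm\left(\int_0^\infty f(u)^m\,du+\frac{\varepsilon}{m}+o(1)\right),$$ where $\varepsilon=\varepsilon_{m}(n)$ satisfies $|\varepsilon|\le 8.4\cdot10^{-5}$ for all $n$ and $m$. -/

import Mathlib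

open MeasureTheory

namespace EHLL

/-- The memory of ExtendedHyperLogLog: every cell `j` holds the counter `C₁[j]` and the bit
`C₂[j]` (`true` stands for `1`). -/
abbrev Sketch (m : ℕ) : Type := Fin m → ℕ × Bool

/-- The initial sketch: all counters are `0`, all bits are `1`. -/
def initial (m : ℕ) : Sketch m := fun _ => (0, true)

/-- The new content of a cell with content `c = (C₁, C₂)` that receives the value `r = ρ(y)`. -/
def cellUpdate (c : ℕ × Bool) (r : ℕ) : ℕ × Bool :=
  if r = c.1 + 1 then (r, true)
  else if c.1 + 1 < r then (r, false)
  else if r + 1 = c.1 ∧ c.2 = false then (c.1, true)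
  else c

/-- Processing of one element whose hash value is `x = (j, r)`: the cell `j` receives `r`. -/
def insert {m : ℕ} (s : Sketch m) (x : Fin m × ℕ) : Sketch m :=
  Function.update s x.1 (cellUpdate (s x.1) x.2)

/-- The sketch after the whole stream `M` has been processed with the hash function `h`. -/
def run {m : ℕ} {V : Type*} (h : V → Fin m × ℕ) (M : List V) : Sketch m :=
  M.foldl (fun s v => insert s (h v)) (initial m)

/-- The indicator `Y = (∑ⱼ 2^(-C₁[j]) + (1 - C₂[j]) 2^(-C₁[j] + 1))⁻¹`. -/
noncomputable def indicator {m : ℕ} (s : Sketch m) : ℝ :=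
  (∑ j : Fin m, ((2 : ℝ) ^ (-((s j).1 : ℤ)) +
    (1 - ((s j).2.toNat : ℝ)) * (2 : ℝ) ^ (-((s j).1 : ℤ) + 1)))⁻¹

/-- A random hash function: the hash values of distinct elements are independent, and each
hash value `(j, r)` consists of a uniform cell `j` and an independent `Geo(1/2)` variable `r`
with values in `{1, 2, …}`. -/
structure IsRandomHash {m : ℕ} {V Ω : Type*} [MeasurableSpace Ω] (P : Measure Ω)
    (h : V → Ω → Fin m × ℕ) : Prop where
  measurable : ∀ v, Measurable (h v)
  indep : ProbabilityTheory.iIndepFun h P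
  law : ∀ (v : V) (j : Fin m) (k : ℕ), 1 ≤ k →
    P.real {ω | h v ω = (j, k)} = (1 / (m : ℝ)) * (1 / 2 : ℝ) ^ k

/-- `f(u) = log₂((2+u)/(1+u)) + log₂((4+3u)/(3+3u)) - log₂((4+u)/(3+u))`. -/
noncomputable def f (u : ℝ) : ℝ :=
  Real.logb 2 ((2 + u) / (1 + u)) + Real.logb 2 ((4 + 3 * u) / (3 + 3 * u))
    - Real.logb 2 ((4 + u) / (3 + u))

end EHLL

namespace EHLL

/-!
Write `Y = X⁻¹`, where `X` is the sum of the values `2^(-C₁[j]) + (1 - C₂[j]) 2^(-C₁[j] + 1)` of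
the cells; `X / m` is the probability that a new hash value changes the sketch.

If the number of distinct elements is Poisson distributed with mean `m x`, the cells are
independent, so `Y = ∫₀^∞ e^(-t X) dt` and the substitution `t = x u` turn `E[Y]` into `x` times the
integral over `u` of the `m`-th power of the Laplace transform of a single cell at `x u`. This
transform is a sum over the scales `x / 2^k`, and Poisson summation shows that it is `f(u)` up to
`O(1 / x)` and a fluctuation that is periodic in `log₂ x`. The fluctuation is small because its
Fourier coefficients carry the factors `Γ(1 + 2πik / log 2)`, of modulus at most `5 * 10⁻⁶`; this
is the source of `ε`.

To return to a fixed number of elements, note that a new element never decreases `Y`, so that the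
mean of `Y` is nondecreasing in the number of elements, and Chebyshev's inequality for the Poisson
law sandwiches it between Poissonized means. That the mean depends on the stream only through the
number of distinct elements follows from the law of the sketch, in which a cell with given content
is described by inclusion–exclusion over sets of values that it has not received.
-/

open Real Filter Topology

/-! ### The Fourier series of the dyadic sums of `y ↦ y e^{-y}` -/

section Gamma

open Complex (Gamma I)

lemma norm_Gamma_one_add_mul_I_sq {y : ℝ} (hy : y ≠ 0) :
    ‖Gamma (1 + y * I)‖ ^ 2 = π * y / sinh (π * y) := by
  have hconj : starRingEnd ℂ (Gamma (1 + y * I)) = Gamma (1 - y * I) := by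
    rw [← Complex.Gamma_conj]
    simp [sub_eq_add_neg]
  have hfunctional : Gamma (1 + y * I) = y * I * Gamma (y * I) := by
    rw [add_comm, Complex.Gamma_add_one _ (by simp [hy])]
  have hsin : Complex.sin (π * (y * I)) = (sinh (π * y) : ℝ) * I := by
    rw [← mul_assoc, Complex.sin_mul_I]
    push_cast
    rfl
  have hsinh : ((sinh (π * y) : ℝ) : ℂ) ≠ 0 := by
    exact_mod_cast sinh_ne_zero.2 (mul_ne_zero pi_ne_zero hy)
  have key : ((‖Gamma (1 + y * I)‖ ^ 2 : ℝ) : ℂ) = (π * y / sinh (π * y) : ℝ) := by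
    rw [Complex.ofReal_pow, ← Complex.mul_conj', hconj, hfunctional, mul_assoc,
      Complex.Gamma_mul_Gamma_one_sub, hsin]
    push_cast at hsinh ⊢
    field_simp
  exact_mod_cast key

lemma sinh_mul_exp_le_sinh_add (x : ℝ) {y : ℝ} (hy : 0 ≤ y) :
    sinh x * exp y ≤ sinh (x + y) := by
  have hexp : exp (-(x + y)) ≤ exp (-x) * exp y := by
    rw [← exp_add]
    gcongr
    linarith
  rw [sinh_eq, sinh_eq, exp_add]
  linarith

lemma pi_mul_two_pi_div_log_two_mem_Icc : π * (2 * π / log 2) ∈ Set.Icc 28.47 28.48 := by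
  have hlog := log_two_gt_d9
  have hlog' := log_two_lt_d9
  have hpi := pi_gt_d6
  have hpi' := pi_lt_d6
  rw [← mul_div_assoc, Set.mem_Icc, le_div_iff₀ (by linarith), div_le_iff₀ (by linarith)]
  constructor <;> nlinarith

lemma le_exp_of_le {x : ℝ} (hx : 28.47 ≤ x) : 2312500000000 ≤ exp x :=
  calc (2312500000000 : ℝ) ≤ 2.7182818283 ^ 28 * 1.5993 := by norm_num
    _ ≤ exp 1 ^ 28 * exp 0.47 := by
        gcongr
        · exact exp_one_gt_d9.le
        · refine le_trans ?_ (sum_le_exp_of_nonneg (by norm_num) 5)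
          norm_num [Finset.sum_range_succ, Nat.factorial]
    _ = exp 28.47 := by
        rw [← exp_nat_mul, ← exp_add]
        norm_num
    _ ≤ exp x := exp_le_exp.2 hx

lemma natCast_succ_mul_div_sinh_le {x : ℝ} (hx : x ∈ Set.Icc 28.47 28.48) (n : ℕ) :
    (n + 1 : ℝ) * x / sinh ((n + 1) * x) ≤ 0.00000497 ^ 2 * (1 / 10 ^ 6) ^ n := by
  have hexp := le_exp_of_le hx.1
  have hx0 : 0 ≤ x := le_trans (by norm_num) hx.1
  have hsinh : (1156000000000 : ℝ) ≤ sinh x := by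
    have : exp (-x) ≤ 1 := exp_le_one_iff.2 (by linarith)
    rw [sinh_eq]
    linarith
  have hpow : (2 * 10 ^ 6 : ℝ) ^ n ≤ exp (n * x) := by
    rw [exp_nat_mul]
    gcongr
    linarith
  have hadd : sinh x * exp (n * x) ≤ sinh ((n + 1) * x) := by
    rw [add_one_mul, add_comm]
    exact sinh_mul_exp_le_sinh_add x (by positivity)
  have hn : (n + 1 : ℝ) ≤ 2 ^ n := by exact_mod_cast Nat.lt_two_pow_self
  calc (n + 1 : ℝ) * x / sinh ((n + 1) * x)
      ≤ 2 ^ n * 28.48 / (1156000000000 * (2 * 10 ^ 6) ^ n) := by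
        gcongr
        · exact hx.2
        · exact le_trans (by gcongr) hadd
    _ = 28.48 / 1156000000000 * (1 / 10 ^ 6) ^ n := by
        rw [mul_pow, one_div_pow]
        field_simp
    _ ≤ 0.00000497 ^ 2 * (1 / 10 ^ 6) ^ n := by
        gcongr
        norm_num

lemma norm_Gamma_one_add_int_mul_I_le {n : ℤ} (hn : n ≠ 0) :
    ‖Gamma (1 + (n * (2 * π / log 2) : ℝ) * I)‖ ≤ 0.00497 * (1 / 1000) ^ n.natAbs := by
  obtain ⟨k, hk⟩ := Nat.exists_eq_add_one_of_ne_zero (Int.natAbs_ne_zero.2 hn)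
  have hω : (2 * π / log 2 : ℝ) ≠ 0 := by positivity
  set ω := 2 * π / log 2
  have heven : π * (n * ω) / sinh (π * (n * ω))
      = (k + 1) * (π * ω) / sinh ((k + 1) * (π * ω)) := by
    rw [show π * (n * ω) = n * (π * ω) by ring]
    obtain h | h : n = k + 1 ∨ n = -(k + 1) := by omega
    all_goals rw [h]; push_cast
    · rfl
    · rw [neg_mul, sinh_neg, neg_div_neg_eq]
  refine le_of_sq_le_sq ?_ (by positivity)
  rw [norm_Gamma_one_add_mul_I_sq (by positivity), heven]
  refine (natCast_succ_mul_div_sinh_le pi_mul_two_pi_div_log_two_mem_Icc k).trans_eq ?_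
  rw [hk, mul_pow, pow_right_comm, pow_succ _ k]
  ring_nf

end Gamma

lemma summable_and_norm_tsum_sub_le {E : Type*} [NormedAddCommGroup E] [CompleteSpace E]
    {c : ℤ → E} {C q : ℝ} (hq : 0 ≤ q) (hq1 : q < 1)
    (hc : ∀ n ≠ 0, ‖c n‖ ≤ C * q ^ n.natAbs) :
    Summable c ∧ ‖∑' n, c n - c 0‖ ≤ 2 * (C * q / (1 - q)) := by
  have hsum : HasSum (fun n : ℕ ↦ C * q * q ^ n) (C * q / (1 - q)) :=
    (hasSum_geometric_of_lt_one hq hq1).mul_left _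
  have hpos : ∀ n : ℕ, ‖c (n + 1 : ℕ)‖ ≤ C * q * q ^ n := fun n ↦
    (hc _ (by omega)).trans_eq (by rw [Int.natAbs_natCast, pow_succ]; ring)
  have hneg : ∀ n : ℕ, ‖c (-(n + 1))‖ ≤ C * q * q ^ n := fun n ↦
    (hc _ (by omega)).trans_eq (by
      rw [Int.natAbs_neg, show ((n : ℤ) + 1).natAbs = n + 1 by omega, pow_succ]; ring)
  have hnat : Summable fun n : ℕ ↦ c n :=
    (summable_nat_add_iff (f := fun n : ℕ ↦ c n) 1).1 (.of_norm_bounded hsum.summable hpos)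
  have hneg' : Summable fun n : ℕ ↦ c (-(n + 1)) := .of_norm_bounded hsum.summable hneg
  refine ⟨.of_nat_of_neg_add_one hnat hneg', ?_⟩
  rw [tsum_of_nat_of_neg_add_one hnat hneg', hnat.tsum_eq_zero_add, Nat.cast_zero, add_assoc,
    add_sub_cancel_left, two_mul]
  exact (norm_add_le _ _).trans
    (add_le_add (tsum_of_norm_bounded hsum hpos) (tsum_of_norm_bounded hsum hneg))

section Gumbel

open FourierTransform

/-- The function `y ↦ y e^{-y}` on the logarithmic scale `y = 2^{-x}`: the density of the Gumbel
law, rescaled. Complex valued in order to apply the Fourier transform. -/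
noncomputable def gumbel (x : ℝ) : ℂ := (2 ^ (-x) * exp (-2 ^ (-x)) : ℝ)

lemma fourier_gumbel (ξ : ℝ) :
    𝓕 gumbel ξ = (log 2 : ℂ)⁻¹ * Complex.Gamma (1 + (ξ * (2 * π / log 2) : ℝ) * Complex.I) := by
  have hlog : 0 < log 2 := log_pos one_lt_two
  set s : ℂ := 1 + (ξ * (2 * π / log 2) : ℝ) * Complex.I with hs
  have hre : s.re = 1 := by
    rw [hs, Complex.add_re, Complex.re_ofReal_mul]
    simp
  have him : s.im = ξ * (2 * π / log 2) := by
    rw [hs, Complex.add_im, Complex.im_ofReal_mul]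
    simp
  have hmellin : Complex.Gamma s = mellin (fun t : ℝ ↦ ((exp (-t) : ℝ) : ℂ)) s := by
    rw [Complex.Gamma_eq_integral (by simp [hre]), Complex.GammaIntegral_eq_mellin]
  rw [hmellin, mellin_eq_fourier, hre, him, fourier_real_eq_integral_exp_smul,
    fourier_real_eq_integral_exp_smul]
  have hscale := Measure.integral_comp_mul_left (fun v : ℝ ↦
    Complex.exp (((-2 * π * v * (ξ * (2 * π / log 2) / (2 * π)) : ℝ) : ℂ) * Complex.I) •
      (exp (-1 * v) • ((exp (-exp (-v)) : ℝ) : ℂ))) (log 2)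
  rw [abs_of_pos (inv_pos.2 hlog)] at hscale
  rw [show (log 2 : ℂ)⁻¹ = ((log 2)⁻¹ : ℝ) by push_cast; rfl, ← Complex.real_smul, ← hscale]
  congr 1 with v
  congr 1
  · congr 3
    field_simp
  · rw [gumbel, rpow_def_of_pos two_pos]
    simp

lemma fourier_gumbel_zero : 𝓕 gumbel 0 = ((log 2)⁻¹ : ℝ) := by
  rw [fourier_gumbel]
  simp

lemma norm_fourier_gumbel_int_le {n : ℤ} (hn : n ≠ 0) :
    ‖𝓕 gumbel n‖ ≤ 0.00497 / log 2 * (1 / 1000) ^ n.natAbs := by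
  rw [fourier_gumbel, norm_mul, norm_inv, Complex.norm_of_nonneg (log_nonneg one_le_two),
    div_mul_eq_mul_div, ← div_eq_inv_mul]
  gcongr
  exact norm_Gamma_one_add_int_mul_I_le hn

lemma continuous_gumbel : Continuous gumbel := by
  unfold gumbel
  fun_prop (disch := norm_num)

lemma sq_le_two_mul_exp {x : ℝ} (hx : 0 ≤ x) : x ^ 2 ≤ 2 * exp x := by
  linarith [quadratic_le_exp_of_nonneg hx]

lemma mul_exp_neg_mul_log_sq_le {y : ℝ} (hy : 0 < y) : y * exp (-y) * log y ^ 2 ≤ 4 := by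
  have hexp : exp y * exp (-y) = 1 := by rw [← exp_add, add_neg_cancel, exp_zero]
  rcases le_total 1 y with h | h
  · have hlog : log y ^ 2 ≤ 2 * y := by
      simpa only [exp_log hy] using sq_le_two_mul_exp (log_nonneg h)
    calc y * exp (-y) * log y ^ 2 ≤ y * exp (-y) * (2 * y) := by gcongr
      _ = 2 * y ^ 2 * exp (-y) := by ring
      _ ≤ 2 * (2 * exp y) * exp (-y) := by gcongr; exact sq_le_two_mul_exp hy.le
      _ = 4 := by linear_combination 4 * hexp
  · have hlog : log y ^ 2 ≤ 2 * y⁻¹ := by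
      simpa only [exp_neg, exp_log hy, neg_sq] using
        sq_le_two_mul_exp (neg_nonneg.2 (log_nonpos hy.le h))
    calc y * exp (-y) * log y ^ 2 ≤ y * 1 * (2 * y⁻¹) := by
          gcongr
          exact exp_le_one_iff.2 (neg_nonpos.2 hy.le)
      _ ≤ 4 := by
          field_simp
          norm_num

lemma gumbel_isBigO : gumbel =O[cocompact ℝ] fun x : ℝ ↦ |x| ^ (-2 : ℝ) := by
  refine .of_bound (4 / log 2 ^ 2) ?_
  filter_upwards [(isCompact_singleton (x := (0 : ℝ))).compl_mem_cocompact] with x hx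
  have hx0 : x ≠ 0 := hx
  have hbound := mul_exp_neg_mul_log_sq_le (rpow_pos_of_pos two_pos (-x))
  rw [log_rpow two_pos] at hbound
  rw [gumbel, Complex.norm_of_nonneg (by positivity), norm_of_nonneg (by positivity),
    rpow_neg (abs_nonneg x), rpow_two, sq_abs, ← div_eq_mul_inv, div_div,
    le_div_iff₀ (by positivity)]
  linarith

/-- The sum of `y ↦ y e^{-y}` over a dyadic progression. It is invariant under `s ↦ 2s` and
oscillates around `1 / log 2`. -/
noncomputable def dyadicSum (s : ℝ) : ℝ := ∑' k : ℤ, s * 2 ^ k * exp (-(s * 2 ^ k))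

lemma tsum_gumbel {s : ℝ} (hs : 0 < s) : ∑' n : ℤ, gumbel (-logb 2 s + n) = dyadicSum s := by
  rw [dyadicSum, Complex.ofReal_tsum, ← (Equiv.neg ℤ).tsum_eq]
  congr 1 with n
  have hpow : (2 : ℝ) ^ (-(-logb 2 s + (-n : ℤ))) = s * 2 ^ n := by
    rw [Int.cast_neg, neg_add, neg_neg, neg_neg, rpow_add two_pos,
      rpow_logb two_pos (by norm_num) hs, rpow_intCast]
  rw [gumbel, Equiv.neg_apply, hpow]

lemma abs_dyadicSum_sub_le {s : ℝ} (hs : 0 < s) : |dyadicSum s - (log 2)⁻¹| ≤ 0.0000145 := by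
  set c : ℤ → ℂ := fun n ↦ 𝓕 gumbel n * fourier n ((-logb 2 s : ℝ) : UnitAddCircle)
  have hc (n : ℤ) : ‖c n‖ = ‖𝓕 gumbel n‖ := by
    rw [norm_mul, fourier_apply, Circle.norm_coe, mul_one]
  have hc0 : c 0 = ((log 2)⁻¹ : ℝ) := by
    simp only [c, Int.cast_zero, fourier_gumbel_zero, fourier_zero, mul_one]
  have hq : (0 : ℝ) ≤ 1 / 1000 ∧ (1 / 1000 : ℝ) < 1 := by norm_num
  have hpoisson : (dyadicSum s : ℂ) = ∑' n, c n := by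
    rw [← tsum_gumbel hs]
    exact tsum_eq_tsum_fourier_of_rpow_decay_of_summable continuous_gumbel one_lt_two gumbel_isBigO
      (summable_and_norm_tsum_sub_le hq.1 hq.2 fun _ ↦ norm_fourier_gumbel_int_le).1 _
  have htail := (summable_and_norm_tsum_sub_le hq.1 hq.2 fun n hn ↦
    (hc n).trans_le (norm_fourier_gumbel_int_le hn)).2
  rw [← hpoisson, hc0, ← Complex.ofReal_sub, Complex.norm_real, norm_eq_abs] at htail
  calc |dyadicSum s - (log 2)⁻¹|
      ≤ 2 * (0.00497 / log 2 * (1 / 1000) / (1 - 1 / 1000)) := htail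
    _ ≤ 2 * (0.00497 / 0.6931471803 * (1 / 1000) / (1 - 1 / 1000)) := by
        gcongr
        exact log_two_gt_d9.le
    _ ≤ 0.0000145 := by norm_num

end Gumbel

/-! ### Dyadic sums of exponential differences -/

lemma dyadicSum_div {s : ℝ} (hs : s ≠ 0) :
    dyadicSum s / s = ∑' k : ℤ, 2 ^ k * exp (-(s * 2 ^ k)) := by
  rw [dyadicSum, ← tsum_div_const]
  congr 1 with k
  field_simp

lemma summable_two_zpow_mul_exp {a : ℝ} (ha : 0 < a) :
    Summable fun k : ℤ ↦ (2 : ℝ) ^ k * exp (-(a * 2 ^ k)) := by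
  refine .of_nat_of_neg
    (.of_nonneg_of_le (fun n ↦ by positivity) (fun n ↦ ?_)
      (summable_geometric_two.mul_left (2 / a ^ 2)))
    (.of_nonneg_of_le (fun n ↦ by positivity) (fun n ↦ ?_) summable_geometric_two)
  · have hexp := sq_le_two_mul_exp (x := a * 2 ^ n) (by positivity)
    rw [zpow_natCast, exp_neg, one_div, inv_pow, ← div_eq_mul_inv, ← div_eq_mul_inv, div_div,
      div_le_div_iff₀ (exp_pos _) (by positivity)]
    linarith
  · rw [zpow_neg, zpow_natCast, one_div, inv_pow]
    exact mul_le_of_le_one_right (by positivity) (exp_le_one_iff.2 (by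
      rw [neg_nonpos]
      positivity))

lemma norm_two_zpow_mul_exp_le {a s : ℝ} (has : a ≤ s) (k : ℤ) :
    ‖(2 : ℝ) ^ k * exp (-(s * 2 ^ k))‖ ≤ 2 ^ k * exp (-(a * 2 ^ k)) := by
  rw [norm_of_nonneg (by positivity)]
  gcongr

lemma intervalIntegrable_dyadicSum_div {a b : ℝ} (ha : 0 < a) (hab : a ≤ b) :
    IntervalIntegrable (fun s ↦ dyadicSum s / s) volume a b := by
  refine ContinuousOn.intervalIntegrable ?_
  rw [Set.uIcc_of_le hab]
  refine ContinuousOn.congr ?_ fun s hs ↦ dyadicSum_div (ha.trans_le hs.1).ne'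
  exact continuousOn_tsum (fun k ↦ by fun_prop) (summable_two_zpow_mul_exp ha)
    fun k s hs ↦ norm_two_zpow_mul_exp_le hs.1 k

lemma integral_mul_exp_neg_mul (a b z : ℝ) :
    ∫ s in a..b, z * exp (-(s * z)) = exp (-(a * z)) - exp (-(b * z)) := by
  have hderiv : ∀ s ∈ Set.uIcc a b,
      HasDerivAt (fun s ↦ -exp (-(s * z))) (z * exp (-(s * z))) s := fun s _ ↦ by
    refine (((hasDerivAt_id s).mul_const z).neg.exp).neg.congr_deriv ?_
    simp only [id_eq, Pi.neg_apply]
    ring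
  rw [intervalIntegral.integral_eq_sub_of_hasDerivAt hderiv
    (Continuous.intervalIntegrable (by fun_prop) _ _)]
  ring

lemma hasSum_exp_sub_exp {a b : ℝ} (ha : 0 < a) (hab : a ≤ b) :
    HasSum (fun k : ℤ ↦ exp (-(a * 2 ^ k)) - exp (-(b * 2 ^ k)))
      (∫ s in a..b, dyadicSum s / s) := by
  have hsum := intervalIntegral.hasSum_intervalIntegral_of_summable_norm (a := a) (b := b)
    (f := fun k : ℤ ↦ (⟨fun s : ℝ ↦ (2 : ℝ) ^ k * exp (-(s * 2 ^ k)), by fun_prop⟩ : C(ℝ, ℝ)))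
    (.of_nonneg_of_le (fun _ ↦ norm_nonneg _) (fun k ↦ by
      rw [ContinuousMap.norm_le _ (by positivity)]
      rintro ⟨s, hs : s ∈ Set.uIcc a b⟩
      rw [Set.uIcc_of_le hab] at hs
      exact norm_two_zpow_mul_exp_le hs.1 k) (summable_two_zpow_mul_exp ha))
  simp only [ContinuousMap.coe_mk, integral_mul_exp_neg_mul] at hsum
  rwa [intervalIntegral.integral_congr fun s hs ↦ ?_]
  rw [Set.uIcc_of_le hab] at hs
  exact dyadicSum_div (ha.trans_le hs.1).ne'

/-- The sum of `e^{-a 2^k} - e^{-b 2^k}` over all integers `k`; its main part is `log₂ (b / a)`. -/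
noncomputable def expDiff (a b : ℝ) : ℝ :=
  ∑' k : ℤ, (exp (-(a * 2 ^ k)) - exp (-(b * 2 ^ k)))

lemma summable_exp_sub_exp {a b : ℝ} (ha : 0 < a) (hb : 0 < b) :
    Summable fun k : ℤ ↦ exp (-(a * 2 ^ k)) - exp (-(b * 2 ^ k)) := by
  rcases le_total a b with h | h
  · exact (hasSum_exp_sub_exp ha h).summable
  · simpa only [neg_sub] using (hasSum_exp_sub_exp hb h).summable.neg

lemma expDiff_add {a b c : ℝ} (ha : 0 < a) (hb : 0 < b) (hc : 0 < c) :
    expDiff a b + expDiff b c = expDiff a c := by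
  simp only [expDiff]
  rw [← (summable_exp_sub_exp ha hb).tsum_add (summable_exp_sub_exp hb hc)]
  simp only [sub_add_sub_cancel]

lemma expDiff_two_mul (a b : ℝ) : expDiff (2 * a) (2 * b) = expDiff a b := by
  simp only [expDiff]
  rw [← (Equiv.addRight (1 : ℤ)).tsum_eq fun k : ℤ ↦ exp (-(a * 2 ^ k)) - exp (-(b * 2 ^ k))]
  congr 1 with k
  rw [Equiv.coe_addRight, zpow_add_one₀ two_ne_zero]
  ring_nf

lemma expDiff_one_two : expDiff 1 2 = 1 := by
  have hsum := (summable_exp_sub_exp one_pos two_pos).hasSum.comp Finset.tendsto_Ico_neg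
  have hterm (k : ℤ) : exp (-(1 * 2 ^ k)) - exp (-(2 * 2 ^ k))
      = exp (-2 ^ k) - exp (-2 ^ (k + 1)) := by
    rw [zpow_add_one₀ two_ne_zero, one_mul, mul_comm]
  simp only [hterm, Function.comp_def, Finset.sum_Ico_int_sub _ fun k : ℤ ↦ exp (-(2 : ℝ) ^ k),
    zpow_neg, zpow_natCast, ← inv_pow] at hsum
  have hbot : Tendsto (fun n : ℕ ↦ exp (-(2⁻¹ : ℝ) ^ n)) atTop (𝓝 (exp (-0))) :=
    (continuous_exp.tendsto _).comp
      (tendsto_pow_atTop_nhds_zero_of_lt_one (by norm_num) (by norm_num)).neg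
  have htop : Tendsto (fun n : ℕ ↦ exp (-(2 : ℝ) ^ n)) atTop (𝓝 0) :=
    tendsto_exp_neg_atTop_nhds_zero.comp (tendsto_pow_atTop_atTop_of_one_lt one_lt_two)
  rw [expDiff]
  simpa only [hterm, neg_zero, exp_zero, sub_zero] using
    tendsto_nhds_unique hsum (hbot.sub htop)

/-- The fluctuation of `b ↦ expDiff 1 b` around `log₂ b`; it is invariant under `b ↦ 2b`. -/
noncomputable def fluctuation (b : ℝ) : ℝ := expDiff 1 b - logb 2 b

lemma expDiff_eq {a b : ℝ} (ha : 0 < a) (hb : 0 < b) :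
    expDiff a b = logb 2 (b / a) + (fluctuation b - fluctuation a) := by
  rw [fluctuation, fluctuation, ← expDiff_add one_pos ha hb, logb_div hb.ne' ha.ne']
  ring

lemma fluctuation_two_mul {b : ℝ} (hb : 0 < b) : fluctuation (2 * b) = fluctuation b := by
  have hshift := expDiff_two_mul 1 b
  rw [mul_one] at hshift
  rw [fluctuation, fluctuation, ← expDiff_add one_pos two_pos (mul_pos two_pos hb), hshift,
    expDiff_one_two, logb_mul two_ne_zero hb.ne', logb_self_eq_one one_lt_two]
  ring

lemma abs_fluctuation_sub_le {a b : ℝ} (ha : 0 < a) (hab : a ≤ b) :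
    |fluctuation b - fluctuation a| ≤ 0.0000145 * log (b / a) := by
  have hb := ha.trans_le hab
  have hinv : IntervalIntegrable (fun s : ℝ ↦ s⁻¹) volume a b :=
    intervalIntegral.intervalIntegrable_inv (fun s hs ↦ by
      rw [Set.uIcc_of_le hab] at hs
      exact (ha.trans_le hs.1).ne') continuousOn_id
  have hlog : ∫ s in a..b, s⁻¹ = log (b / a) := integral_inv_of_pos ha hb
  have hfluct : fluctuation b - fluctuation a
      = ∫ s in a..b, (dyadicSum s - (log 2)⁻¹) * s⁻¹ := by
    have hexpDiff : expDiff a b = ∫ s in a..b, dyadicSum s / s :=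
      (hasSum_exp_sub_exp ha hab).tsum_eq
    rw [expDiff_eq ha hb, logb, ← hlog] at hexpDiff
    simp only [sub_mul, ← div_eq_mul_inv (dyadicSum _)]
    rw [intervalIntegral.integral_sub (intervalIntegrable_dyadicSum_div ha hab)
      (hinv.const_mul _), intervalIntegral.integral_const_mul, ← hexpDiff]
    ring
  rw [hfluct, ← hlog, ← intervalIntegral.integral_const_mul, ← norm_eq_abs]
  refine intervalIntegral.norm_integral_le_of_norm_le hab (.of_forall fun s hs ↦ ?_)
    (hinv.const_mul _)
  have hs0 : 0 < s := ha.trans hs.1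
  rw [norm_mul, norm_eq_abs, norm_of_nonneg (inv_nonneg.2 hs0.le)]
  gcongr
  exact abs_dyadicSum_sub_le hs0

/-! ### Bounds on `f` -/

lemma log_le_half_sub_inv {y : ℝ} (hy : 1 ≤ y) : log y ≤ (y - y⁻¹) / 2 := by
  have h := self_le_sinh_iff.2 (log_nonneg hy)
  rwa [sinh_eq, exp_neg, exp_log (by linarith)] at h

lemma log_add_one_div_le {c : ℝ} (hc : 0 < c) : log ((c + 1) / c) ≤ (1 / c + 1 / (c + 1)) / 2 := by
  refine (log_le_half_sub_inv ?_).trans (le_of_eq ?_)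
  · rw [le_div_iff₀ hc]; linarith
  · field_simp; ring

lemma le_log_add_one_div {c : ℝ} (hc : 0 < c) : 2 / (2 * c + 1) ≤ log ((c + 1) / c) := by
  have h := le_log_one_add_of_nonneg (x := 1 / c) (by positivity)
  convert h using 1
  · field_simp; ring
  · congr 1; field_simp

lemma log_div_le {a b : ℝ} (ha : 0 < a) (hb : 0 < b) : log (b / a) ≤ (b - a) / a := by
  refine (log_le_sub_one_of_pos (by positivity)).trans (le_of_eq ?_)
  field_simp

/-- The function `f` with natural logarithms in place of binary ones. -/
noncomputable def logProfile (u : ℝ) : ℝ :=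
  log ((2 + u) / (1 + u)) + log ((4 + 3 * u) / (3 + 3 * u)) - log ((4 + u) / (3 + u))

lemma f_eq_logProfile_div (u : ℝ) : f u = logProfile u / log 2 := by
  simp only [f, logProfile, logb]
  ring

lemma logProfile_zero : logProfile 0 = log 2 := by
  norm_num [logProfile]

lemma hasDerivAt_log_div_of_mul_add {a b c u : ℝ} (ha : 0 < a + b * u) (hc : 0 < c + b * u) :
    HasDerivAt (fun u ↦ log ((a + b * u) / (c + b * u)))
      (-(b * (a - c) / ((c + b * u) * (a + b * u)))) u := by
  have hlin (d : ℝ) : HasDerivAt (fun u ↦ d + b * u) b u := by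
    simpa using ((hasDerivAt_id u).const_mul b).const_add d
  convert ((hlin a).fun_div (hlin c) hc.ne').log (by positivity) using 1
  field_simp
  ring

lemma hasDerivAt_logProfile {u : ℝ} (hu : 0 ≤ u) :
    HasDerivAt logProfile
      (-(1 / ((1 + u) * (2 + u)) + 1 / ((1 + u) * (4 + 3 * u)) - 1 / ((3 + u) * (4 + u)))) u := by
  have h₁ := hasDerivAt_log_div_of_mul_add (a := 2) (b := 1) (c := 1) (u := u)
    (by positivity) (by positivity)
  have h₂ := hasDerivAt_log_div_of_mul_add (a := 4) (b := 3) (c := 3) (u := u)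
    (by positivity) (by positivity)
  have h₃ := hasDerivAt_log_div_of_mul_add (a := 4) (b := 1) (c := 3) (u := u)
    (by positivity) (by positivity)
  simp only [one_mul] at h₁ h₃
  refine ((h₁.add h₂).sub h₃).congr_deriv ?_
  rw [show 3 + 3 * u = 3 * (1 + u) by ring]
  field_simp
  ring

lemma deriv_logProfile_bound {u : ℝ} (h0 : 0 ≤ u) (h1 : u ≤ 1) :
    log 2 * 0.95 / (1 + 0.95 * u) ^ 2 ≤
      1 / ((1 + u) * (2 + u)) + 1 / ((1 + u) * (4 + 3 * u)) - 1 / ((3 + u) * (4 + u)) := by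
  have hlog : log 2 * 0.95 ≤ 0.6585 := by linarith [log_two_lt_d9]
  calc log 2 * 0.95 / (1 + 0.95 * u) ^ 2 ≤ 0.6585 / (1 + 0.95 * u) ^ 2 := by gcongr
    _ ≤ ((4 + 3 * u) * (3 + u) * (4 + u) + (2 + u) * (3 + u) * (4 + u)
          - (1 + u) * (2 + u) * (4 + 3 * u))
          / ((1 + u) * (2 + u) * (4 + 3 * u) * (3 + u) * (4 + u)) := by
      rw [div_le_div_iff₀ (by positivity) (by positivity)]
      have h4 : u ^ 4 ≤ u := pow_le_of_le_one h0 h1 (by norm_num)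
      have h5 : u ^ 5 ≤ u := pow_le_of_le_one h0 h1 (by norm_num)
      nlinarith [pow_nonneg h0 2, pow_nonneg h0 3]
    _ = _ := by field_simp

lemma logProfile_le_of_le_one {u : ℝ} (hu : 0 ≤ u) (hu1 : u ≤ 1) :
    logProfile u ≤ log 2 / (1 + 0.95 * u) := by
  have hderiv {v : ℝ} (hv : 0 ≤ v) : HasDerivAt (fun v ↦ log 2 / (1 + 0.95 * v) - logProfile v)
      (-(log 2 * 0.95 / (1 + 0.95 * v) ^ 2) - -(1 / ((1 + v) * (2 + v)) +
        1 / ((1 + v) * (4 + 3 * v)) - 1 / ((3 + v) * (4 + v)))) v := by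
    refine HasDerivAt.sub ?_ (hasDerivAt_logProfile hv)
    have hlin : HasDerivAt (fun v : ℝ ↦ 1 + 0.95 * v) 0.95 v := by
      simpa using ((hasDerivAt_id v).const_mul 0.95).const_add 1
    simpa [neg_div] using (hasDerivAt_const v (log 2)).fun_div hlin (by positivity)
  have hmono : MonotoneOn (fun v ↦ log 2 / (1 + 0.95 * v) - logProfile v) (Set.Icc 0 1) :=
    monotoneOn_of_hasDerivWithinAt_nonneg (convex_Icc 0 1)
      (fun v hv ↦ (hderiv hv.1).continuousAt.continuousWithinAt)
      (fun v hv ↦ (hderiv (interior_subset hv).1).hasDerivWithinAt) fun v hv ↦ by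
        have hv' : v ∈ Set.Icc (0 : ℝ) 1 := interior_subset hv
        linarith [deriv_logProfile_bound hv'.1 hv'.2]
  have h := hmono (Set.left_mem_Icc.2 zero_le_one) ⟨hu, hu1⟩ hu
  simp only [mul_zero, add_zero, div_one, logProfile_zero, sub_self] at h
  linarith

lemma logProfile_le_rat {u : ℝ} (hu : 0 ≤ u) :
    logProfile u ≤ (1 / (1 + u) + 1 / (2 + u)) / 2 + (1 / (3 + 3 * u) + 1 / (4 + 3 * u)) / 2
      - 2 / (2 * (3 + u) + 1) := by
  have h₁ := log_add_one_div_le (c := 1 + u) (by linarith)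
  have h₂ := log_add_one_div_le (c := 3 + 3 * u) (by linarith)
  have h₃ := le_log_add_one_div (c := 3 + u) (by linarith)
  rw [show 1 + u + 1 = 2 + u by ring] at h₁
  rw [show 3 + 3 * u + 1 = 4 + 3 * u by ring] at h₂
  rw [show 3 + u + 1 = 4 + u by ring] at h₃
  rw [logProfile]
  linarith

lemma logProfile_le_of_one_le {u : ℝ} (hu : 1 ≤ u) : logProfile u ≤ log 2 / (1 + 0.95 * u) := by
  obtain ⟨v, hv, rfl⟩ : ∃ v, 0 ≤ v ∧ u = 1 + v := ⟨u - 1, by linarith, by ring⟩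
  have hrat : 0.6931 / (1 + 0.95 * (1 + v)) - ((1 / (1 + (1 + v)) + 1 / (2 + (1 + v))) / 2 +
      (1 / (3 + 3 * (1 + v)) + 1 / (4 + 3 * (1 + v))) / 2 - 2 / (2 * (3 + (1 + v)) + 1))
      = (27.5508 + 188.2746 * v + 219.3144 * v ^ 2 + 93.2606 * v ^ 3 + 13.5516 * v ^ 4) /
        (6 * (2 + v) * (3 + v) * (7 + 3 * v) * (9 + 2 * v) * (1.95 + 0.95 * v)) := by
    rw [show 3 + 3 * (1 + v) = 3 * (2 + v) by ring, show 1 + (1 + v) = 2 + v by ring,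
      show 2 + (1 + v) = 3 + v by ring, show 4 + 3 * (1 + v) = 7 + 3 * v by ring,
      show 2 * (3 + (1 + v)) + 1 = 9 + 2 * v by ring,
      show 1 + 0.95 * (1 + v) = 1.95 + 0.95 * v by ring]
    field_simp
    ring
  have hpos : 0 ≤ (27.5508 + 188.2746 * v + 219.3144 * v ^ 2 + 93.2606 * v ^ 3 + 13.5516 * v ^ 4) /
      (6 * (2 + v) * (3 + v) * (7 + 3 * v) * (9 + 2 * v) * (1.95 + 0.95 * v)) := by
    positivity
  calc logProfile (1 + v) ≤ _ := logProfile_le_rat (by linarith)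
    _ ≤ 0.6931 / (1 + 0.95 * (1 + v)) := by linarith
    _ ≤ log 2 / (1 + 0.95 * (1 + v)) := by
      gcongr
      linarith [log_two_gt_d9]

lemma logProfile_le {u : ℝ} (hu : 0 ≤ u) : logProfile u ≤ log 2 / (1 + 0.95 * u) :=
  (le_total u 1).elim (logProfile_le_of_le_one hu) logProfile_le_of_one_le

lemma logProfile_nonneg {u : ℝ} (hu : 0 ≤ u) : 0 ≤ logProfile u := by
  have h : log ((4 + u) / (3 + u)) ≤ log ((2 + u) / (1 + u)) := by
    refine log_le_log (by positivity) ?_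
    rw [div_le_div_iff₀ (by positivity) (by positivity)]
    nlinarith
  have h' : 0 ≤ log ((4 + 3 * u) / (3 + 3 * u)) := log_nonneg (by
    rw [le_div_iff₀ (by positivity)]; linarith)
  rw [logProfile]
  linarith

lemma f_nonneg {u : ℝ} (hu : 0 ≤ u) : 0 ≤ f u := by
  rw [f_eq_logProfile_div]
  exact div_nonneg (logProfile_nonneg hu) (log_nonneg one_le_two)

lemma f_le {u : ℝ} (hu : 0 ≤ u) : f u ≤ 1 / (1 + 0.95 * u) := by
  rw [f_eq_logProfile_div, div_le_iff₀ (log_pos one_lt_two), one_div_mul_eq_div]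
  exact logProfile_le hu

/-- The oscillating error term that accompanies `f u` in the Laplace transform of a cell whose
expected number of elements is `x`. -/
noncomputable def profileFluctuation (x u : ℝ) : ℝ :=
  (fluctuation (x * (2 + u)) - fluctuation (x * (1 + u)))
    - (fluctuation (x * (4 + u)) - fluctuation (x * (3 + u)))
    + (fluctuation (x * (4 + 3 * u)) - fluctuation (x * (3 + 3 * u)))

lemma logProfile_eq {u : ℝ} (hu : 0 ≤ u) : logProfile u = log (2 + u) - log (1 + u) +
    (log (4 + 3 * u) - log (3 + 3 * u)) - (log (4 + u) - log (3 + u)) := by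
  rw [logProfile, log_div (by positivity) (by positivity), log_div (by positivity) (by positivity),
    log_div (by positivity) (by positivity)]

section FluctuationBounds

variable {x u : ℝ}

lemma abs_fluctuation_mul_sub_le {a b : ℝ} (hx : 0 < x) (ha : 0 < a) (hab : a ≤ b) :
    |fluctuation (x * b) - fluctuation (x * a)| ≤ 0.0000145 * log (b / a) := by
  have h := abs_fluctuation_sub_le (mul_pos hx ha) (mul_le_mul_of_nonneg_left hab hx.le)
  rwa [mul_div_mul_left _ _ hx.ne'] at h

lemma fluctuation_mul_half {b : ℝ} (hx : 0 < x) (hb : 0 < b) :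
    fluctuation (x * (b / 2)) = fluctuation (x * b) := by
  rw [← fluctuation_two_mul (by positivity)]
  ring_nf

lemma abs_profileFluctuation_le_small (hx : 0 < x) (hu : 0 ≤ u) :
    |profileFluctuation x u| ≤ 0.0000145 * (7 / 6 * u) := by
  -- By 2-periodicity, the six arguments are those of three short intervals shrinking with `u`.
  have hperiod : profileFluctuation x u
      = (fluctuation (x * ((2 + u) / 2)) - fluctuation (x * ((4 + u) / 2 / 2)))
        - (fluctuation (x * (1 + u)) - fluctuation (x * ((4 + 3 * u) / 2 / 2)))
        - (fluctuation (x * (3 + 3 * u)) - fluctuation (x * (3 + u))) := by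
    rw [profileFluctuation]
    iterate 5 rw [fluctuation_mul_half hx (by positivity)]
    ring
  have h₁ := abs_fluctuation_mul_sub_le (x := x) (a := (4 + u) / 2 / 2) (b := (2 + u) / 2)
    hx (by positivity) (by linarith)
  have h₂ := abs_fluctuation_mul_sub_le (x := x) (a := (4 + 3 * u) / 2 / 2) (b := 1 + u)
    hx (by positivity) (by linarith)
  have h₃ := abs_fluctuation_mul_sub_le (x := x) (a := 3 + u) (b := 3 + 3 * u)
    hx (by positivity) (by linarith)
  have hlog {a b c : ℝ} (ha : 0 < a) (hb : 0 < b) (h : b - a ≤ c * a) : log (b / a) ≤ c :=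
    (log_div_le ha hb).trans ((div_le_iff₀ ha).2 h)
  have l₁ : log ((2 + u) / 2 / ((4 + u) / 2 / 2)) ≤ u / 4 :=
    hlog (by positivity) (by positivity) (by nlinarith)
  have l₂ : log ((1 + u) / ((4 + 3 * u) / 2 / 2)) ≤ u / 4 :=
    hlog (by positivity) (by positivity) (by nlinarith)
  have l₃ : log ((3 + 3 * u) / (3 + u)) ≤ 2 / 3 * u :=
    hlog (by positivity) (by positivity) (by nlinarith)
  rw [hperiod]
  rw [abs_le] at h₁ h₂ h₃ ⊢
  constructor <;> linarith

lemma profileFluctuation_eq_half (hx : 0 < x) (hu : 0 ≤ u) :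
    profileFluctuation x u
      = (fluctuation (x * (2 + u)) - fluctuation (x * ((4 + u) / 2)))
        + (fluctuation (x * ((3 + u) / 2)) - fluctuation (x * (1 + u)))
        + (fluctuation (x * (4 + 3 * u)) - fluctuation (x * (3 + 3 * u))) := by
  rw [profileFluctuation, fluctuation_mul_half hx (by positivity),
    fluctuation_mul_half hx (by positivity)]
  ring

lemma abs_profileFluctuation_le_logProfile (hx : 0 < x) (hu : 0 ≤ u) (hu1 : u ≤ 1) :
    |profileFluctuation x u| ≤ 0.0000145 * logProfile u := by
  have h₁ := abs_fluctuation_mul_sub_le (x := x) (a := 1 + u) (b := (3 + u) / 2)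
    hx (by positivity) (by linarith)
  have h₂ := abs_fluctuation_mul_sub_le (x := x) (a := (4 + u) / 2) (b := 2 + u)
    hx (by positivity) (by linarith)
  have h₃ := abs_fluctuation_mul_sub_le (x := x) (a := 3 + 3 * u) (b := 4 + 3 * u)
    hx (by positivity) (by linarith)
  have hlog : logProfile u = log ((3 + u) / 2 / (1 + u)) + log ((2 + u) / ((4 + u) / 2))
      + log ((4 + 3 * u) / (3 + 3 * u)) := by
    rw [logProfile_eq hu]
    repeat rw [log_div (by positivity) (by positivity)]
    ring
  rw [hlog, profileFluctuation_eq_half hx hu]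
  rw [abs_le] at h₁ h₂ h₃ ⊢
  constructor <;> linarith

lemma abs_profileFluctuation_le_logProfile_add (hx : 0 < x) (hu : 1 ≤ u) :
    |profileFluctuation x u| ≤ 0.0000145 * (logProfile u + 2 * log (2 * (1 + u) / (3 + u))) := by
  have hu0 : 0 ≤ u := by linarith
  have h₁ := abs_fluctuation_mul_sub_le (x := x) (a := (3 + u) / 2) (b := 1 + u)
    hx (by positivity) (by linarith)
  have h₂ := abs_fluctuation_mul_sub_le (x := x) (a := (4 + u) / 2) (b := 2 + u)
    hx (by positivity) (by linarith)
  have h₃ := abs_fluctuation_mul_sub_le (x := x) (a := 3 + 3 * u) (b := 4 + 3 * u)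
    hx (by positivity) (by linarith)
  have hlog : logProfile u + 2 * log (2 * (1 + u) / (3 + u))
      = log ((1 + u) / ((3 + u) / 2)) + log ((2 + u) / ((4 + u) / 2))
      + log ((4 + 3 * u) / (3 + 3 * u)) := by
    rw [logProfile_eq hu0]
    repeat rw [log_div (by positivity) (by positivity)]
    rw [log_mul (by positivity) (by positivity)]
    ring
  rw [hlog, profileFluctuation_eq_half hx hu0]
  rw [abs_le] at h₁ h₂ h₃ ⊢
  constructor <;> linarith

lemma abs_profileFluctuation_le_add_log (hx : 0 < x) (hu : 0 ≤ u) :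
    |profileFluctuation x u| ≤ 0.0000145 * (log ((2 + u) / (1 + u))
      + log ((4 + 3 * u) / (3 + 3 * u)) + log ((4 + u) / (3 + u))) := by
  have h₁ := abs_fluctuation_mul_sub_le (x := x) (a := 1 + u) (b := 2 + u)
    hx (by positivity) (by linarith)
  have h₂ := abs_fluctuation_mul_sub_le (x := x) (a := 3 + u) (b := 4 + u)
    hx (by positivity) (by linarith)
  have h₃ := abs_fluctuation_mul_sub_le (x := x) (a := 3 + 3 * u) (b := 4 + 3 * u)
    hx (by positivity) (by linarith)
  rw [profileFluctuation]
  rw [abs_le] at h₁ h₂ h₃ ⊢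
  constructor <;> linarith

lemma logProfile_add_two_mul_log_le (h1 : 1 ≤ u) (h2 : u ≤ 1.9) :
    logProfile u + 2 * log (2 * (1 + u) / (3 + u)) ≤ 2.5 * u / (1 + 0.95 * u) ^ 2 := by
  have hu : 0 ≤ u := by linarith
  have hlog : 2 * log (2 * (1 + u) / (3 + u)) ≤
      2 * (1 + u) / (3 + u) - (2 * (1 + u) / (3 + u))⁻¹ := by
    have h1' : 1 ≤ 2 * (1 + u) / (3 + u) := by
      rw [le_div_iff₀ (by positivity)]; linarith
    linarith [log_le_half_sub_inv h1']
  have hprofile : logProfile u ≤ 0.69315 / (1 + 0.95 * u) := by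
    refine (logProfile_le hu).trans ?_
    gcongr
    linarith [log_two_lt_d9]
  have hrat : 2.5 * u / (1 + 0.95 * u) ^ 2 -
      (0.69315 / (1 + 0.95 * u) + (2 * (1 + u) / (3 + u) - (2 * (1 + u) / (3 + u))⁻¹))
      = (5 * u * (1 + u) * (3 + u) - 1.3863 * (1 + 0.95 * u) * (1 + u) * (3 + u)
        - (4 * (1 + u) ^ 2 - (3 + u) ^ 2) * (1 + 0.95 * u) ^ 2)
        / (2 * (1 + u) * (3 + u) * (1 + 0.95 * u) ^ 2) := by
    field_simp
    ring
  have hpos : 0 ≤ 5 * u * (1 + u) * (3 + u) - 1.3863 * (1 + 0.95 * u) * (1 + u) * (3 + u)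
      - (4 * (1 + u) ^ 2 - (3 + u) ^ 2) * (1 + 0.95 * u) ^ 2 := by
    obtain ⟨v, hv, hv1, rfl⟩ : ∃ v, 0 ≤ v ∧ v ≤ 0.9 ∧ u = 1 + v :=
      ⟨u - 1, by linarith, by linarith, by ring⟩
    have p2 : v ^ 2 ≤ 0.9 * v := by nlinarith
    have p3 : v ^ 3 ≤ 0.81 * v := by nlinarith
    have p4 : v ^ 4 ≤ 0.729 * v := by nlinarith
    nlinarith
  have := div_nonneg hpos (by positivity : 0 ≤ 2 * (1 + u) * (3 + u) * (1 + 0.95 * u) ^ 2)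
  linarith

lemma add_log_le (hu : 1.9 ≤ u) :
    log ((2 + u) / (1 + u)) + log ((4 + 3 * u) / (3 + 3 * u)) + log ((4 + u) / (3 + u))
      ≤ 2.5 * u / (1 + 0.95 * u) ^ 2 := by
  obtain ⟨v, hv, rfl⟩ : ∃ v, 0 ≤ v ∧ u = 1.9 + v := ⟨u - 1.9, by linarith, by ring⟩
  have h₁ := log_add_one_div_le (c := 1 + (1.9 + v)) (by positivity)
  have h₂ := log_add_one_div_le (c := 3 + 3 * (1.9 + v)) (by positivity)
  have h₃ := log_add_one_div_le (c := 3 + (1.9 + v)) (by positivity)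
  rw [show 1 + (1.9 + v) + 1 = 2 + (1.9 + v) by ring] at h₁
  rw [show 3 + 3 * (1.9 + v) + 1 = 4 + 3 * (1.9 + v) by ring] at h₂
  rw [show 3 + (1.9 + v) + 1 = 4 + (1.9 + v) by ring] at h₃
  have hrat : (1 / (1 + (1.9 + v)) + 1 / (2 + (1.9 + v))) / 2
      + (1 / (3 + 3 * (1.9 + v)) + 1 / (4 + 3 * (1.9 + v))) / 2
      + (1 / (3 + (1.9 + v)) + 1 / (4 + (1.9 + v))) / 2
      ≤ 2.5 * (1.9 + v) / (1 + 0.95 * (1.9 + v)) ^ 2 := by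
    rw [show 3 + 3 * (1.9 + v) = 3 * (1 + (1.9 + v)) by ring, ← sub_nonneg]
    field_simp
    ring_nf
    positivity
  linarith

lemma abs_profileFluctuation_le (hx : 0 < x) (hu : 0 ≤ u) :
    |profileFluctuation x u| ≤ 0.0000145 * (2.5 * u / (1 + 0.95 * u) ^ 2) := by
  have hlog := log_two_lt_d9
  rcases le_total u 0.45 with h1 | h1
  · refine (abs_profileFluctuation_le_small hx hu).trans ?_
    gcongr
    rw [le_div_iff₀ (by positivity)]
    have : (1 + 0.95 * u) ^ 2 ≤ 2.1 := by nlinarith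
    nlinarith
  rcases le_total u 1 with h2 | h2
  · refine (abs_profileFluctuation_le_logProfile hx hu h2).trans ?_
    gcongr
    refine (logProfile_le hu).trans ?_
    have hW : 0 < 1 + 0.95 * u := by positivity
    have : log 2 * (1 + 0.95 * u) ≤ 2.5 * u := by nlinarith
    rw [div_le_div_iff₀ hW (by positivity)]
    nlinarith
  rcases le_total u 1.9 with h3 | h3
  · refine (abs_profileFluctuation_le_logProfile_add hx h2).trans ?_
    gcongr
    exact logProfile_add_two_mul_log_le h2 h3
  · refine (abs_profileFluctuation_le_add_log hx hu).trans ?_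
    gcongr
    exact add_log_le h3

end FluctuationBounds

/-! ### The Laplace transform of a single cell -/

/-- The contribution `2^(-C₁) + (1 - C₂) 2^(-C₁ + 1)` of a cell `(C₁, C₂)` to the inverse of the
indicator. -/
noncomputable def cellValue (c : ℕ × Bool) : ℝ :=
  (2 : ℝ) ^ (-(c.1 : ℤ)) + (1 - (c.2.toNat : ℝ)) * (2 : ℝ) ^ (-(c.1 : ℤ) + 1)

/-- The probability that a cell has the content `c = (k, b)` after a Poisson number of elements
with mean `x`: no value above `k` has arrived, `k` itself has (unless `k = 0`), and `k - 1` has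
or has not, according to `b` (always counted as arrived if `k ≤ 1`). -/
noncomputable def cellLaw (x : ℝ) (c : ℕ × Bool) : ℝ :=
  exp (-(x * 2 ^ (-(c.1 : ℤ)))) *
    (1 - (if c.1 = 0 then 0 else 1) * exp (-(x * 2 ^ (-(c.1 : ℤ))))) *
    ((if c.2 then 1 else 0) + (if c.2 then -1 else 1) * (if c.1 ≤ 1 then 0 else 1) *
      exp (-(x * 2 ^ (-(c.1 : ℤ) + 1))))

lemma cellLaw_nonneg {x : ℝ} (hx : 0 ≤ x) (c : ℕ × Bool) : 0 ≤ cellLaw x c := by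
  have hexp (k : ℤ) : 0 < exp (-(x * 2 ^ k)) ∧ exp (-(x * 2 ^ k)) ≤ 1 :=
    ⟨exp_pos _, exp_le_one_iff.2 (neg_nonpos.2 (by positivity))⟩
  obtain ⟨h₁, h₁'⟩ := hexp (-c.1)
  obtain ⟨h₂, h₂'⟩ := hexp (-c.1 + 1)
  rw [cellLaw]
  refine mul_nonneg (mul_nonneg h₁.le ?_) ?_
  · split_ifs <;> linarith
  · split_ifs <;> linarith

/-- The contribution of a counter value `k ≥ 2` to the Laplace transform of `cellValue` at the
argument `x * u` under `cellLaw x`, written in terms of `y = x * 2^(-k)`. -/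
noncomputable def levelTerm (u y : ℝ) : ℝ :=
  exp (-y) * (1 - exp (-y)) *
    ((1 - exp (-(2 * y))) * exp (-(u * y)) + exp (-(2 * y)) * exp (-(3 * u * y)))

lemma levelTerm_eq (u y : ℝ) : levelTerm u y =
    (exp (-((1 + u) * y)) - exp (-((2 + u) * y))) - (exp (-((3 + u) * y)) - exp (-((4 + u) * y)))
      + (exp (-((3 + 3 * u) * y)) - exp (-((4 + 3 * u) * y))) := by
  have hexp (n : ℕ) (w : ℝ) : exp (-((n + w) * y)) = exp (-y) ^ n * exp (-(w * y)) := by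
    rw [← exp_nat_mul, ← exp_add]
    ring_nf
  have h₁ := hexp 1 u
  have h₂ := hexp 2 u
  have h₃ := hexp 3 u
  have h₄ := hexp 4 u
  have h₃' := hexp 3 (3 * u)
  have h₄' := hexp 4 (3 * u)
  have h₂' := hexp 2 0
  push_cast at h₁ h₂ h₃ h₄ h₂' h₃' h₄'
  rw [add_zero, zero_mul, neg_zero, exp_zero, mul_one] at h₂'
  rw [levelTerm, h₁, h₂, h₃, h₄, h₂', h₃', h₄']
  ring

lemma exp_neg_le_inv {z : ℝ} (hz : 0 < z) : exp (-z) ≤ z⁻¹ := by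
  rw [exp_neg]
  exact inv_anti₀ hz (by linarith [add_one_le_exp z])

lemma levelTerm_nonneg {u y : ℝ} (hy : 0 ≤ y) : 0 ≤ levelTerm u y := by
  have h₁ : exp (-y) ≤ 1 := exp_le_one_iff.2 (by linarith)
  have h₂ : exp (-(2 * y)) ≤ 1 := exp_le_one_iff.2 (by linarith)
  rw [levelTerm]
  refine mul_nonneg (mul_nonneg (exp_pos _).le (by linarith)) (add_nonneg ?_ (by positivity))
  exact mul_nonneg (by linarith) (exp_pos _).le

lemma levelTerm_le {u y : ℝ} (hu : 0 ≤ u) (hy : 0 < y) :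
    levelTerm u y ≤ 2 * ((1 + u) * y)⁻¹ := by
  have h₁ := exp_neg_le_inv (z := (1 + u) * y) (by positivity)
  have h₂ : exp (-((4 + u) * y)) ≤ exp (-((3 + u) * y)) := exp_le_exp.2 (by nlinarith)
  have h₃ : exp (-((3 + 3 * u) * y)) ≤ exp (-((1 + u) * y)) :=
    exp_le_exp.2 (by nlinarith [mul_nonneg hu hy.le])
  rw [levelTerm_eq]
  linarith [exp_pos (-((2 + u) * y)), exp_pos (-((4 + 3 * u) * y))]

lemma hasSum_exp_mul_sub_exp_mul {x a b : ℝ} (hx : 0 < x) (ha : 0 < a) (hb : 0 < b) :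
    HasSum (fun k : ℤ ↦ exp (-(a * (x * 2 ^ k))) - exp (-(b * (x * 2 ^ k))))
      (logb 2 (b / a) + (fluctuation (x * b) - fluctuation (x * a))) := by
  have h := (summable_exp_sub_exp (mul_pos hx ha) (mul_pos hx hb)).hasSum
  rw [← expDiff, expDiff_eq (mul_pos hx ha) (mul_pos hx hb), mul_div_mul_left _ _ hx.ne'] at h
  convert h using 5 <;> ring

lemma hasSum_levelTerm {x u : ℝ} (hx : 0 < x) (hu : 0 ≤ u) :
    HasSum (fun k : ℤ ↦ levelTerm u (x * 2 ^ k)) (f u + profileFluctuation x u) := by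
  have h := ((hasSum_exp_mul_sub_exp_mul (a := 1 + u) (b := 2 + u) hx
      (by positivity) (by positivity)).sub
    (hasSum_exp_mul_sub_exp_mul (a := 3 + u) (b := 4 + u) hx (by positivity) (by positivity))).add
    (hasSum_exp_mul_sub_exp_mul (a := 3 + 3 * u) (b := 4 + 3 * u) hx
      (by positivity) (by positivity))
  have hval : f u + profileFluctuation x u =
      logb 2 ((2 + u) / (1 + u)) + (fluctuation (x * (2 + u)) - fluctuation (x * (1 + u))) -
      (logb 2 ((4 + u) / (3 + u)) + (fluctuation (x * (4 + u)) - fluctuation (x * (3 + u)))) +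
      (logb 2 ((4 + 3 * u) / (3 + 3 * u)) +
        (fluctuation (x * (4 + 3 * u)) - fluctuation (x * (3 + 3 * u)))) := by
    rw [f, profileFluctuation]
    ring
  simp only [levelTerm_eq]
  rw [hval]
  exact h

/-- The Laplace transform at `t` of the value of a cell that has received a Poisson number of
elements with mean `x`. -/
noncomputable def cellTransform (x t : ℝ) : ENNReal :=
  ∑' c : ℕ × Bool, ENNReal.ofReal (cellLaw x c * exp (-(t * cellValue c)))

lemma measurable_cellTransform (x : ℝ) : Measurable (cellTransform x) :=
  Measurable.tsum fun c ↦ by fun_prop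

/-- The contribution of the counter value `k` to `cellTransform x (x * u)`. -/
noncomputable def counterTerm (x u : ℝ) (k : ℕ) : ℝ :=
  cellLaw x (k, true) * exp (-(x * u * cellValue (k, true))) +
    cellLaw x (k, false) * exp (-(x * u * cellValue (k, false)))

lemma counterTerm_nonneg {x : ℝ} (hx : 0 ≤ x) (u : ℝ) (k : ℕ) : 0 ≤ counterTerm x u k :=
  add_nonneg (mul_nonneg (cellLaw_nonneg hx _) (exp_pos _).le)
    (mul_nonneg (cellLaw_nonneg hx _) (exp_pos _).le)

lemma counterTerm_zero_le {x u : ℝ} (hx : 0 < x) (hu : 0 ≤ u) :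
    counterTerm x u 0 ≤ (x * (1 + u))⁻¹ := by
  have h : counterTerm x u 0 = exp (-(x * (1 + u))) := by
    rw [show -(x * (1 + u)) = -x + -(x * u) by ring, exp_add]
    simp [counterTerm, cellLaw, cellValue]
  rw [h]
  exact exp_neg_le_inv (by positivity)

lemma counterTerm_one_le {x u : ℝ} (hx : 0 < x) (hu : 0 ≤ u) :
    counterTerm x u 1 ≤ 2 * (x * (1 + u))⁻¹ := by
  calc counterTerm x u 1 = exp (-(x * 2⁻¹)) * (1 - exp (-(x * 2⁻¹))) * exp (-(x * u * 2⁻¹)) := by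
        simp [counterTerm, cellLaw, cellValue]
    _ ≤ exp (-(x * 2⁻¹)) * 1 * exp (-(x * u * 2⁻¹)) := by
        gcongr
        linarith [exp_pos (-(x * 2⁻¹))]
    _ = exp (-(x * (1 + u) / 2)) := by
        rw [mul_one, ← exp_add]
        ring_nf
    _ ≤ (x * (1 + u) / 2)⁻¹ := exp_neg_le_inv (by positivity)
    _ = 2 * (x * (1 + u))⁻¹ := by rw [inv_div, div_eq_mul_inv]

lemma counterTerm_add_two (x u : ℝ) (k : ℕ) :
    counterTerm x u (k + 2) = levelTerm u (x * 2 ^ (-((k + 2 : ℕ) : ℤ))) := by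
  have hpow : (2 : ℝ) ^ (-((k + 2 : ℕ) : ℤ) + 1) = 2 * 2 ^ (-((k + 2 : ℕ) : ℤ)) := by
    rw [zpow_add_one₀ two_ne_zero, mul_comm]
  simp only [counterTerm, cellLaw, cellValue, levelTerm, hpow]
  generalize (2 : ℝ) ^ (-((k + 2 : ℕ) : ℤ)) = z
  have h₁ : x * u * (z + 2 * z) = 3 * u * (x * z) := by ring
  have h₂ : x * (2 * z) = 2 * (x * z) := by ring
  have h₃ : x * u * z = u * (x * z) := by ring
  simp [h₁, h₂, h₃]
  ring

section CounterSum

variable {x u : ℝ} (hx : 0 < x) (hu : 0 ≤ u)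
include hx hu

lemma summable_levelTerm_neg : Summable fun n : ℕ ↦ levelTerm u (x * 2 ^ (-(n : ℤ))) :=
  (hasSum_levelTerm hx hu).summable.comp_injective
    (i := fun n : ℕ ↦ -(n : ℤ)) (neg_injective.comp Nat.cast_injective)

lemma summable_levelTerm_add_one :
    Summable fun n : ℕ ↦ levelTerm u (x * 2 ^ ((n : ℤ) + 1)) :=
  (hasSum_levelTerm hx hu).summable.comp_injective
    (i := fun n : ℕ ↦ (n : ℤ) + 1) ((add_left_injective 1).comp Nat.cast_injective)

lemma tsum_levelTerm_add_one_le :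
    ∑' n : ℕ, levelTerm u (x * 2 ^ ((n : ℤ) + 1)) ≤ 2 * (x * (1 + u))⁻¹ := by
  have hgeom : HasSum (fun n : ℕ ↦ (x * (1 + u))⁻¹ * ((1 / 2 : ℝ) ^ n)) ((x * (1 + u))⁻¹ * 2) :=
    hasSum_geometric_two.mul_left _
  rw [mul_comm, ← hgeom.tsum_eq]
  refine (summable_levelTerm_add_one hx hu).tsum_le_tsum (fun n ↦ ?_) hgeom.summable
  refine (levelTerm_le hu (by positivity)).trans (le_of_eq ?_)
  rw [zpow_add_one₀ two_ne_zero, zpow_natCast, one_div, inv_pow]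
  field_simp

lemma tsum_levelTerm_neg_add_tsum :
    ∑' n : ℕ, levelTerm u (x * 2 ^ (-(n : ℤ))) + ∑' n : ℕ, levelTerm u (x * 2 ^ ((n : ℤ) + 1))
      = f u + profileFluctuation x u := by
  have hneg : HasSum (fun k : ℤ ↦ levelTerm u (x * 2 ^ (-k))) (f u + profileFluctuation x u) :=
    (Equiv.neg ℤ).hasSum_iff.2 (hasSum_levelTerm hx hu)
  refine (HasSum.of_nat_of_neg_add_one (f := fun k : ℤ ↦ levelTerm u (x * 2 ^ (-k)))
    (summable_levelTerm_neg hx hu).hasSum ?_).unique hneg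
  simpa only [neg_neg] using (summable_levelTerm_add_one hx hu).hasSum

lemma abs_counterTerm_sub_levelTerm_le {k : ℕ} (hk : k < 2) :
    |counterTerm x u k - levelTerm u (x * 2 ^ (-(k : ℤ)))| ≤ 2 * 2 ^ k * (x * (1 + u))⁻¹ := by
  have hz : 0 < (x * (1 + u))⁻¹ := by positivity
  refine abs_sub_le_of_nonneg_of_le (counterTerm_nonneg hx.le u k) ?_
    (levelTerm_nonneg (by positivity)) ?_
  · interval_cases k
    · linarith [counterTerm_zero_le hx hu]
    · linarith [counterTerm_one_le hx hu]
  · refine (levelTerm_le hu (by positivity)).trans (le_of_eq ?_)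
    rw [zpow_neg, zpow_natCast]
    field_simp

lemma summable_counterTerm : Summable (counterTerm x u) := by
  refine (summable_nat_add_iff 2).1 ?_
  simp only [counterTerm_add_two]
  exact (summable_nat_add_iff (f := fun n : ℕ ↦ levelTerm u (x * 2 ^ (-(n : ℤ)))) 2).2
    (summable_levelTerm_neg hx hu)

lemma cellTransform_eq_ofReal_tsum :
    cellTransform x (x * u) = ENNReal.ofReal (∑' k, counterTerm x u k) := by
  rw [ENNReal.ofReal_tsum_of_nonneg (counterTerm_nonneg hx.le u) (summable_counterTerm hx hu),
    cellTransform, ENNReal.tsum_prod']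
  congr 1 with k
  rw [tsum_bool, counterTerm, ENNReal.ofReal_add, add_comm] <;>
    exact mul_nonneg (cellLaw_nonneg hx.le _) (exp_pos _).le

lemma abs_tsum_counterTerm_sub_le :
    |∑' k, counterTerm x u k - (f u + profileFluctuation x u)| ≤ 8 * (x * (1 + u))⁻¹ := by
  have h₀ := abs_counterTerm_sub_levelTerm_le hx hu zero_lt_two
  have h₁ := abs_counterTerm_sub_levelTerm_le hx hu one_lt_two
  have h₂ := tsum_levelTerm_add_one_le hx hu
  have h₃ : 0 ≤ ∑' n : ℕ, levelTerm u (x * 2 ^ ((n : ℤ) + 1)) :=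
    tsum_nonneg fun n ↦ levelTerm_nonneg (by positivity)
  rw [← tsum_levelTerm_neg_add_tsum hx hu, ← (summable_counterTerm hx hu).sum_add_tsum_nat_add 2,
    ← (summable_levelTerm_neg hx hu).sum_add_tsum_nat_add 2]
  simp only [counterTerm_add_two, Finset.sum_range_succ, Finset.sum_range_zero]
  rw [abs_le] at h₀ h₁ ⊢
  constructor <;> linarith

lemma cellTransform_ne_top : cellTransform x (x * u) ≠ ⊤ := by
  rw [cellTransform_eq_ofReal_tsum hx hu]
  exact ENNReal.ofReal_ne_top

lemma abs_toReal_cellTransform_sub_le :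
    |(cellTransform x (x * u)).toReal - (f u + profileFluctuation x u)|
      ≤ 8 * (x * (1 + u))⁻¹ := by
  rw [cellTransform_eq_ofReal_tsum hx hu,
    ENNReal.toReal_ofReal (tsum_nonneg (counterTerm_nonneg hx.le u))]
  exact abs_tsum_counterTerm_sub_le hx hu

end CounterSum

/-! ### The expectation in the Poisson model -/

section RationalIntegrals

variable {b : ℝ} (hb : 0 < b) (p : ℕ)
include hb

lemma hasDerivAt_neg_inv_one_add_mul_pow {u : ℝ} (hu : 0 ≤ u) :
    HasDerivAt (fun u : ℝ ↦ -(b * (p + 1))⁻¹ * ((1 + b * u) ^ (p + 1))⁻¹)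
      (((1 + b * u) ^ (p + 2))⁻¹) u := by
  have hlin : HasDerivAt (fun u : ℝ ↦ 1 + b * u) b u := by
    simpa using ((hasDerivAt_id u).const_mul b).const_add 1
  refine (((hlin.fun_pow (p + 1)).fun_inv (by positivity)).const_mul _).congr_deriv ?_
  rw [Nat.add_sub_cancel]
  push_cast
  field_simp
  ring

lemma tendsto_neg_inv_one_add_mul_pow :
    Tendsto (fun u : ℝ ↦ -(b * (p + 1))⁻¹ * ((1 + b * u) ^ (p + 1))⁻¹) atTop (𝓝 0) := by
  have hlin : Tendsto (fun u : ℝ ↦ 1 + b * u) atTop atTop :=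
    tendsto_atTop_add_const_left _ _ (tendsto_id.const_mul_atTop hb)
  have hpow := (tendsto_pow_atTop (α := ℝ) (n := p + 1) (by omega)).comp hlin
  simpa using hpow.inv_tendsto_atTop.const_mul (-(b * (p + 1))⁻¹)

lemma integrableOn_inv_one_add_mul_pow :
    IntegrableOn (fun u : ℝ ↦ ((1 + b * u) ^ (p + 2))⁻¹) (Set.Ioi 0) :=
  integrableOn_Ioi_deriv_of_nonneg' (fun _ hu ↦ hasDerivAt_neg_inv_one_add_mul_pow hb p hu)
    (fun u (hu : 0 < u) ↦ by positivity) (tendsto_neg_inv_one_add_mul_pow hb p)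

lemma integral_inv_one_add_mul_pow :
    ∫ u in Set.Ioi (0 : ℝ), ((1 + b * u) ^ (p + 2))⁻¹ = 1 / (b * (p + 1)) := by
  rw [integral_Ioi_of_hasDerivAt_of_nonneg'
    (fun _ hu ↦ hasDerivAt_neg_inv_one_add_mul_pow hb p hu)
    (fun u (hu : 0 < u) ↦ by positivity) (tendsto_neg_inv_one_add_mul_pow hb p)]
  simp

lemma mul_inv_one_add_mul_pow_eq {u : ℝ} (hu : 0 < u) :
    u * ((1 + b * u) ^ (p + 3))⁻¹
      = b⁻¹ * (((1 + b * u) ^ (p + 2))⁻¹ - ((1 + b * u) ^ (p + 1 + 2))⁻¹) := by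
  rw [show p + 1 + 2 = p + 2 + 1 by ring, show p + 3 = p + 2 + 1 by ring, pow_succ _ (p + 2)]
  field_simp
  ring

lemma integrableOn_mul_inv_one_add_mul_pow :
    IntegrableOn (fun u : ℝ ↦ u * ((1 + b * u) ^ (p + 3))⁻¹) (Set.Ioi 0) :=
  IntegrableOn.congr_fun (((integrableOn_inv_one_add_mul_pow hb p).sub
    (integrableOn_inv_one_add_mul_pow hb (p + 1))).const_mul b⁻¹)
    (fun _ hu ↦ (mul_inv_one_add_mul_pow_eq hb p hu).symm) measurableSet_Ioi

lemma integral_mul_inv_one_add_mul_pow :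
    ∫ u in Set.Ioi (0 : ℝ), u * ((1 + b * u) ^ (p + 3))⁻¹
      = 1 / (b ^ 2 * ((p + 1) * (p + 2))) := by
  rw [setIntegral_congr_fun measurableSet_Ioi fun _ hu ↦ mul_inv_one_add_mul_pow_eq hb p hu,
    integral_const_mul, integral_sub (integrableOn_inv_one_add_mul_pow hb p)
      (integrableOn_inv_one_add_mul_pow hb (p + 1)),
    integral_inv_one_add_mul_pow hb, integral_inv_one_add_mul_pow hb]
  push_cast
  field_simp
  ring

end RationalIntegrals

lemma continuousOn_f : ContinuousOn f (Set.Ioi 0) := by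
  refine ContinuousOn.congr (f := fun u ↦ logProfile u / log 2) ?_ fun u _ ↦
    f_eq_logProfile_div u
  exact ContinuousOn.div_const (fun u (hu : 0 < u) ↦
    (hasDerivAt_logProfile hu.le).continuousAt.continuousWithinAt) _

lemma integrableOn_f_pow {m : ℕ} (hm : 2 ≤ m) :
    IntegrableOn (fun u : ℝ ↦ f u ^ m) (Set.Ioi 0) := by
  obtain ⟨p, rfl⟩ := Nat.exists_eq_add_of_le' hm
  refine (integrableOn_inv_one_add_mul_pow (b := 0.95) (by norm_num) p).mono'
    ((continuousOn_f.pow _).aestronglyMeasurable measurableSet_Ioi) ?_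
  refine ae_restrict_of_forall_mem measurableSet_Ioi fun u (hu : 0 < u) ↦ ?_
  rw [norm_pow, norm_of_nonneg (f_nonneg hu.le), ← inv_pow]
  gcongr
  · exact f_nonneg hu.le
  · simpa using f_le hu.le

/-- The expectation of `indicator`, divided by `x`, when every cell has independently received a
Poisson number of elements with mean `x`. -/
noncomputable def poissonIntegral (m : ℕ) (x : ℝ) : ENNReal :=
  ∫⁻ u in Set.Ioi (0 : ℝ), cellTransform x (x * u) ^ m

lemma f_add_abs_profileFluctuation_le {x u : ℝ} (hx : 0 < x) (hu : 0 ≤ u) :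
    f u + |profileFluctuation x u| ≤ (1 + 0.9499 * u)⁻¹ := by
  have hrat : (1 + 0.9499 * u)⁻¹
      - (1 / (1 + 0.95 * u) + 0.0000145 * (2.5 * u / (1 + 0.95 * u) ^ 2))
      = u * (0.0001 * (1 + 0.95 * u) - 0.00003625 * (1 + 0.9499 * u)) /
        ((1 + 0.9499 * u) * (1 + 0.95 * u) ^ 2) := by
    field_simp
    ring
  have hpos : 0 ≤ u * (0.0001 * (1 + 0.95 * u) - 0.00003625 * (1 + 0.9499 * u)) /
      ((1 + 0.9499 * u) * (1 + 0.95 * u) ^ 2) :=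
    div_nonneg (mul_nonneg hu (by linarith)) (by positivity)
  linarith [f_le hu, abs_profileFluctuation_le hx hu]

lemma abs_f_le {u : ℝ} (hu : 0 ≤ u) : |f u| ≤ (1 + 0.9499 * u)⁻¹ := by
  rw [abs_of_nonneg (f_nonneg hu)]
  linarith [f_add_abs_profileFluctuation_le one_pos hu, abs_nonneg (profileFluctuation 1 u)]

lemma abs_f_add_profileFluctuation_le {x u : ℝ} (hx : 0 < x) (hu : 0 ≤ u) :
    |f u + profileFluctuation x u| ≤ (1 + 0.9499 * u)⁻¹ := by
  refine (abs_add_le _ _).trans ?_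
  rw [abs_of_nonneg (f_nonneg hu)]
  exact f_add_abs_profileFluctuation_le hx hu

lemma abs_f_add_profileFluctuation_pow_sub_le {x u : ℝ} (hx : 0 < x) (hu : 0 ≤ u) (p : ℕ) :
    |(f u + profileFluctuation x u) ^ (p + 2) - f u ^ (p + 2)|
      ≤ (p + 2) * (0.0000145 * 2.5) * (u * ((1 + 0.9499 * u) ^ (p + 3))⁻¹) := by
  have hfluct : |profileFluctuation x u| ≤ 0.0000145 * (2.5 * u / (1 + 0.9499 * u) ^ 2) := by
    refine (abs_profileFluctuation_le hx hu).trans ?_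
    gcongr
    norm_num
  refine (abs_pow_sub_pow_le _ _ _).trans ?_
  rw [add_sub_cancel_left, show p + 2 - 1 = p + 1 by omega]
  calc |profileFluctuation x u| * ((p + 2 : ℕ) : ℝ)
        * max |f u + profileFluctuation x u| |f u| ^ (p + 1)
      ≤ (0.0000145 * (2.5 * u / (1 + 0.9499 * u) ^ 2)) * ((p + 2 : ℕ) : ℝ)
        * ((1 + 0.9499 * u)⁻¹) ^ (p + 1) := by
        gcongr
        exact max_le (abs_f_add_profileFluctuation_le hx hu) (abs_f_le hu)
    _ = _ := by
        push_cast
        rw [inv_pow, show p + 3 = 2 + (p + 1) by ring, pow_add]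
        field_simp
        ring

lemma abs_cellTransform_pow_sub_le {x u : ℝ} (hx : 1 ≤ x) (hu : 0 ≤ u) (p : ℕ) :
    |(cellTransform x (x * u)).toReal ^ (p + 2) - (f u + profileFluctuation x u) ^ (p + 2)|
      ≤ (8 * (p + 2) * 10 ^ (p + 1) / x) * ((1 + 1 * u) ^ (p + 2))⁻¹ := by
  have hx0 : 0 < x := by linarith
  have hT := abs_toReal_cellTransform_sub_le hx0 hu
  have hf : |f u + profileFluctuation x u| ≤ 2 * (1 + u)⁻¹ := by
    refine (abs_f_add_profileFluctuation_le hx0 hu).trans ?_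
    rw [← div_eq_mul_inv, inv_eq_one_div, div_le_div_iff₀ (by positivity) (by positivity)]
    linarith
  have hinv : (x * (1 + u))⁻¹ ≤ (1 + u)⁻¹ := inv_anti₀ (by positivity) (by nlinarith)
  have hpos : 0 ≤ (1 + u)⁻¹ := by positivity
  have hT' : |(cellTransform x (x * u)).toReal| ≤ 10 * (1 + u)⁻¹ := by
    linarith [abs_sub_abs_le_abs_sub (cellTransform x (x * u)).toReal
      (f u + profileFluctuation x u)]
  refine (abs_pow_sub_pow_le _ _ _).trans ?_
  rw [show p + 2 - 1 = p + 1 by omega]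
  calc |(cellTransform x (x * u)).toReal - (f u + profileFluctuation x u)| * ((p + 2 : ℕ) : ℝ)
        * max |(cellTransform x (x * u)).toReal| |f u + profileFluctuation x u| ^ (p + 1)
      ≤ (8 * (x * (1 + u))⁻¹) * ((p + 2 : ℕ) : ℝ) * (10 * (1 + u)⁻¹) ^ (p + 1) := by
        gcongr
        exact max_le hT' (by linarith)
    _ = _ := by
        push_cast
        rw [one_mul, mul_pow, inv_pow, show p + 2 = 1 + (p + 1) by ring, pow_add]
        field_simp
        ring

/-- An integrable bound for the difference of the `(p + 2)`-nd powers of the cell transform and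
of `f`: the first summand is due to the fluctuations, the second one to truncating the sum over
all counter values `k : ℤ` to `k ≥ 0`. -/
noncomputable def transformErrorBound (p : ℕ) (x u : ℝ) : ℝ :=
  (p + 2) * (0.0000145 * 2.5) * (u * ((1 + 0.9499 * u) ^ (p + 3))⁻¹)
    + (8 * (p + 2) * 10 ^ (p + 1) / x) * ((1 + 1 * u) ^ (p + 2))⁻¹

lemma integrableOn_transformErrorBound (p : ℕ) (x : ℝ) :
    IntegrableOn (transformErrorBound p x) (Set.Ioi 0) :=
  ((integrableOn_mul_inv_one_add_mul_pow (by norm_num) p).const_mul _).add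
    ((integrableOn_inv_one_add_mul_pow one_pos p).const_mul _)

lemma integral_transformErrorBound_le (p : ℕ) {x : ℝ} (hx : 0 < x) :
    ∫ u in Set.Ioi (0 : ℝ), transformErrorBound p x u
      ≤ 0.000084 / (p + 2) + 8 * (p + 2) * 10 ^ (p + 2) / x := by
  simp only [transformErrorBound]
  rw [integral_add ((integrableOn_mul_inv_one_add_mul_pow (by norm_num) p).const_mul _)
      ((integrableOn_inv_one_add_mul_pow one_pos p).const_mul _),
    integral_const_mul, integral_const_mul, integral_mul_inv_one_add_mul_pow (by norm_num),
    integral_inv_one_add_mul_pow one_pos]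
  refine add_le_add ?_ ?_
  · calc ((p : ℝ) + 2) * (0.0000145 * 2.5) * (1 / (0.9499 ^ 2 * (((p : ℝ) + 1) * (p + 2))))
        = (0.0000145 * 2.5 / 0.9499 ^ 2) / ((p : ℝ) + 1) := by field_simp
      _ ≤ 0.000084 / ((p : ℝ) + 2) := by
        rw [div_le_div_iff₀ (by positivity) (by positivity)]
        nlinarith [p.cast_nonneg (α := ℝ)]
  · have hinv : 1 / (1 * ((p : ℝ) + 1)) ≤ 1 := by
      rw [div_le_one (by positivity)]
      linarith [p.cast_nonneg (α := ℝ)]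
    calc 8 * ((p : ℝ) + 2) * 10 ^ (p + 1) / x * (1 / (1 * ((p : ℝ) + 1)))
        ≤ 8 * ((p : ℝ) + 2) * 10 ^ (p + 2) / x * 1 := by
          gcongr <;> norm_num
      _ = _ := mul_one _

lemma abs_cellTransform_pow_sub_f_pow_le {x u : ℝ} (hx : 1 ≤ x) (hu : 0 ≤ u) (p : ℕ) :
    |(cellTransform x (x * u)).toReal ^ (p + 2) - f u ^ (p + 2)| ≤ transformErrorBound p x u := by
  refine (abs_sub_le _ ((f u + profileFluctuation x u) ^ (p + 2)) _).trans ?_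
  rw [transformErrorBound, add_comm]
  exact add_le_add (abs_f_add_profileFluctuation_pow_sub_le (by linarith) hu p)
    (abs_cellTransform_pow_sub_le hx hu p)

lemma ae_norm_cellTransform_pow_sub_f_pow_le {x : ℝ} (hx : 1 ≤ x) (p : ℕ) :
    ∀ᵐ u ∂volume.restrict (Set.Ioi 0),
      ‖(cellTransform x (x * u)).toReal ^ (p + 2) - f u ^ (p + 2)‖ ≤ transformErrorBound p x u :=
  ae_restrict_of_forall_mem measurableSet_Ioi fun _ (hu : 0 < _) ↦
    abs_cellTransform_pow_sub_f_pow_le hx hu.le p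

lemma integrableOn_cellTransform_pow {x : ℝ} (hx : 1 ≤ x) (p : ℕ) :
    IntegrableOn (fun u ↦ (cellTransform x (x * u)).toReal ^ (p + 2)) (Set.Ioi 0) := by
  have hf := integrableOn_f_pow (m := p + 2) (by omega)
  have hmeas : Measurable fun u ↦ (cellTransform x (x * u)).toReal ^ (p + 2) :=
    ((measurable_cellTransform x).comp (measurable_const_mul x)).ennreal_toReal.pow_const _
  have hdiff : IntegrableOn
      (fun u ↦ (cellTransform x (x * u)).toReal ^ (p + 2) - f u ^ (p + 2)) (Set.Ioi 0) :=
    (integrableOn_transformErrorBound p x).mono'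
      (hmeas.aestronglyMeasurable.sub hf.aestronglyMeasurable)
      (ae_norm_cellTransform_pow_sub_f_pow_le hx p)
  simpa [Pi.add_def] using hdiff.add hf

lemma poissonIntegral_eq_ofReal {x : ℝ} (hx : 1 ≤ x) (p : ℕ) :
    poissonIntegral (p + 2) x
      = ENNReal.ofReal (∫ u in Set.Ioi (0 : ℝ), (cellTransform x (x * u)).toReal ^ (p + 2)) := by
  rw [ofReal_integral_eq_lintegral_ofReal (integrableOn_cellTransform_pow hx p)
    (Eventually.of_forall fun u ↦ by positivity), poissonIntegral]
  refine setLIntegral_congr_fun measurableSet_Ioi fun u (hu : 0 < u) ↦ ?_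
  rw [ENNReal.ofReal_pow ENNReal.toReal_nonneg,
    ENNReal.ofReal_toReal (cellTransform_ne_top (by linarith) hu.le)]

lemma poissonIntegral_ne_top {m : ℕ} (hm : 2 ≤ m) {x : ℝ} (hx : 1 ≤ x) :
    poissonIntegral m x ≠ ⊤ := by
  obtain ⟨p, rfl⟩ := Nat.exists_eq_add_of_le' hm
  rw [poissonIntegral_eq_ofReal hx]
  exact ENNReal.ofReal_ne_top

lemma abs_poissonIntegral_sub_le {m : ℕ} (hm : 2 ≤ m) {x : ℝ} (hx : 1 ≤ x) :
    |(poissonIntegral m x).toReal - ∫ u in Set.Ioi (0 : ℝ), f u ^ m|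
      ≤ 0.000084 / m + 8 * m * 10 ^ m / x := by
  obtain ⟨p, rfl⟩ := Nat.exists_eq_add_of_le' hm
  rw [poissonIntegral_eq_ofReal hx, ENNReal.toReal_ofReal (integral_nonneg fun u ↦ by positivity),
    ← integral_sub (integrableOn_cellTransform_pow hx p) (integrableOn_f_pow hm), ← norm_eq_abs]
  push_cast
  exact (norm_integral_le_of_norm_le (integrableOn_transformErrorBound p x)
    (ae_norm_cellTransform_pow_sub_f_pow_le hx p)).trans
    (integral_transformErrorBound_le p (by linarith))

/-! ### Poisson weights and de-Poissonization -/

/-- The probability `e^{-l} lⁿ / n!` that a Poisson variable with parameter `l` takes the value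
`n`. The parameter is a real number, so that it can be moved freely; the weights are nonnegative
only for `0 ≤ l`. -/
noncomputable def poissonWeight (l : ℝ) (n : ℕ) : ℝ :=
  exp (-l) * (l ^ n / n.factorial)

lemma poissonWeight_nonneg {l : ℝ} (hl : 0 ≤ l) (n : ℕ) : 0 ≤ poissonWeight l n := by
  rw [poissonWeight]
  positivity

lemma hasSum_poissonWeight_mul_pow (l q : ℝ) :
    HasSum (fun n ↦ poissonWeight l n * q ^ n) (exp (-(l * (1 - q)))) := by
  have hexp := (NormedSpace.expSeries_div_hasSum_exp (𝔸 := ℝ) (l * q)).mul_left (exp (-l))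
  rw [← exp_eq_exp_ℝ, ← exp_add, show -l + l * q = -(l * (1 - q)) by ring] at hexp
  refine hexp.congr_fun fun n ↦ ?_
  rw [poissonWeight, mul_pow]
  ring

lemma hasSum_poissonWeight (l : ℝ) : HasSum (poissonWeight l) 1 := by
  simpa using hasSum_poissonWeight_mul_pow l 1

lemma succ_mul_poissonWeight_succ (l : ℝ) (n : ℕ) :
    ((n + 1 : ℕ) : ℝ) * poissonWeight l (n + 1) = l * poissonWeight l n := by
  rw [poissonWeight, poissonWeight, Nat.factorial_succ]
  push_cast
  field_simp
  ring

lemma hasSum_mul_poissonWeight (l : ℝ) : HasSum (fun n : ℕ ↦ n * poissonWeight l n) l := by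
  rw [← hasSum_nat_add_iff' 1]
  simp only [succ_mul_poissonWeight_succ]
  simpa using (hasSum_poissonWeight l).mul_left l

lemma hasSum_sq_mul_poissonWeight (l : ℝ) :
    HasSum (fun n : ℕ ↦ (n : ℝ) ^ 2 * poissonWeight l n) (l * (l + 1)) := by
  rw [← hasSum_nat_add_iff' 1]
  have hshift (n : ℕ) : ((n + 1 : ℕ) : ℝ) ^ 2 * poissonWeight l (n + 1)
      = l * (n * poissonWeight l n + poissonWeight l n) := by
    rw [sq, mul_assoc, succ_mul_poissonWeight_succ]
    push_cast
    ring
  simp only [hshift]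
  simpa using ((hasSum_mul_poissonWeight l).add (hasSum_poissonWeight l)).mul_left l

lemma hasSum_sq_sub_mul_poissonWeight (l : ℝ) :
    HasSum (fun n : ℕ ↦ ((n : ℝ) - l) ^ 2 * poissonWeight l n) l := by
  have hsum := ((hasSum_sq_mul_poissonWeight l).sub
    ((hasSum_mul_poissonWeight l).mul_left (2 * l))).add
    ((hasSum_poissonWeight l).mul_left (l ^ 2))
  rw [show l * (l + 1) - 2 * l * l + l ^ 2 * 1 = l by ring] at hsum
  exact hsum.congr_fun fun n ↦ by ring

section Depoissonization

variable {a : ℕ → ℝ} {l p A B C d : ℝ} {n : ℕ}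

lemma mul_one_sub_le_of_hasSum_poissonWeight (ha : Monotone a) (ha0 : ∀ n, 0 ≤ a n)
    (hp : HasSum (fun n ↦ poissonWeight l n * a n) p) (hl : n < l) :
    a n * (1 - l / (l - n) ^ 2) ≤ p := by
  have hl0 : 0 ≤ l := n.cast_nonneg.trans hl.le
  have hchebyshev := ((hasSum_poissonWeight l).sub
    ((hasSum_sq_sub_mul_poissonWeight l).div_const ((l - n) ^ 2))).mul_left (a n)
  refine hasSum_le (fun k ↦ ?_) hchebyshev hp
  have hw := poissonWeight_nonneg hl0 k
  rcases le_or_gt n k with hnk | hkn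
  · have hdev : 0 ≤ ((k : ℝ) - l) ^ 2 * poissonWeight l k / (l - n) ^ 2 := by positivity
    nlinarith [ha hnk, ha0 n]
  · have hkn' : (k : ℝ) < n := by exact_mod_cast hkn
    have hdev : poissonWeight l k ≤ ((k : ℝ) - l) ^ 2 * poissonWeight l k / (l - n) ^ 2 := by
      rw [le_div_iff₀ (pow_pos (sub_pos.2 hl) 2), mul_comm]
      gcongr ?_ * _
      nlinarith
    nlinarith [mul_nonneg hw (ha0 k), ha0 n]

lemma mul_le_div_mul_sub_sq {k : ℝ} (hC : 0 ≤ C) (hd : 0 < d) (hd1 : d ≤ 1) (hn : 0 < n)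
    (hk : n < k) : C * k ≤ C / (d ^ 2 * n) * (k - (1 - d) * n) ^ 2 := by
  have hn' : (0 : ℝ) < n := by exact_mod_cast hn
  have hfar : d * k ≤ k - (1 - d) * n := by nlinarith
  have hsq : (d * k) * (d * n) ≤ (k - (1 - d) * n) ^ 2 := by
    have hdk : 0 ≤ d * k := (mul_pos hd (hn'.trans hk)).le
    rw [sq]
    exact mul_le_mul hfar (by nlinarith) (by positivity) (hdk.trans hfar)
  rw [div_mul_eq_mul_div, le_div_iff₀ (by positivity)]
  calc C * k * (d ^ 2 * n) = C * ((d * k) * (d * n)) := by ring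
    _ ≤ C * (k - (1 - d) * n) ^ 2 := by gcongr

lemma le_add_div_of_hasSum_poissonWeight (ha : Monotone a) (ha0 : ∀ n, 0 ≤ a n)
    (hp : HasSum (fun k ↦ poissonWeight ((1 - d) * n) k * a k) p) (hn : 0 < n) (hC : 0 ≤ C)
    (haC : ∀ k, n < k → a k ≤ C * k) (hd : 0 < d) (hd1 : d ≤ 1) :
    p ≤ a n + C / d ^ 2 := by
  have hn' : (0 : ℝ) < n := by exact_mod_cast hn
  have hl0 : 0 ≤ (1 - d) * n := mul_nonneg (by linarith) hn'.le
  have hchebyshev := ((hasSum_poissonWeight ((1 - d) * n)).mul_left (a n)).add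
    ((hasSum_sq_sub_mul_poissonWeight ((1 - d) * n)).mul_left (C / (d ^ 2 * n)))
  calc p ≤ a n * 1 + C / (d ^ 2 * n) * ((1 - d) * n) := by
        refine hasSum_le (fun k ↦ ?_) hp hchebyshev
        have hbound : a k ≤ a n + C / (d ^ 2 * n) * (k - (1 - d) * n) ^ 2 := by
          rcases le_or_gt k n with hkn | hnk
          · exact (ha hkn).trans (le_add_of_nonneg_right (by positivity))
          · exact (haC k hnk).trans (le_add_of_nonneg_of_le (ha0 n)
              (mul_le_div_mul_sub_sq hC hd hd1 hn (by exact_mod_cast hnk)))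
        linarith [mul_le_mul_of_nonneg_right hbound (poissonWeight_nonneg hl0 k)]
    _ = a n + C / d ^ 2 * (1 - d) := by field_simp
    _ ≤ a n + C / d ^ 2 := by
        gcongr
        exact mul_le_of_le_one_right (by positivity) (by linarith)

variable {p : ℝ → ℝ}

lemma eventually_le_mul (ha : Monotone a) (ha0 : ∀ n, 0 ≤ a n)
    (hp : ∀ᶠ l in atTop, HasSum (fun n ↦ poissonWeight l n * a n) (p l))
    (hpA : ∀ᶠ l in atTop, p l ≤ A * l) (hAB : A < B) :
    ∀ᶠ n : ℕ in atTop, a n ≤ B * n := by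
  obtain ⟨d, hdA, hd⟩ : ∃ d, A * (1 + d) < B ∧ 0 < d := by
    have hlim : Tendsto (fun d ↦ A * (1 + d)) (𝓝 0) (𝓝 A) :=
      Continuous.tendsto' (by fun_prop) _ _ (by simp)
    exact (((hlim.mono_left nhdsWithin_le_nhds).eventually_lt_const hAB).and
      (self_mem_nhdsWithin (s := Set.Ioi 0))).exists
  set r : ℕ → ℝ := fun n ↦ 1 - (1 + d) / d ^ 2 / n
  have hr1 : Tendsto r atTop (𝓝 1) := by
    rw [← sub_zero (1 : ℝ)]
    exact (tendsto_const_div_atTop_nhds_zero_nat ((1 + d) / d ^ 2)).const_sub 1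
  have hscale : Tendsto (fun n : ℕ ↦ (1 + d) * (n : ℝ)) atTop atTop :=
    tendsto_natCast_atTop_atTop.const_mul_atTop (by positivity)
  filter_upwards [hscale.eventually hp, hscale.eventually hpA, eventually_gt_atTop 0,
    hr1.eventually_const_lt one_pos,
    (hr1.const_mul B).eventually_const_lt (by simpa using hdA)] with n hpn hpAn hn hrn hBr
  have hn' : (0 : ℝ) < n := by exact_mod_cast hn
  have hchebyshev := mul_one_sub_le_of_hasSum_poissonWeight ha ha0 hpn (n := n) (by nlinarith)
  have hrn_eq : (1 + d) * n / ((1 + d) * n - n) ^ 2 = (1 + d) / d ^ 2 / n := by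
    rw [show (1 + d) * (n : ℝ) - n = d * n by ring]
    field_simp
  rw [hrn_eq] at hchebyshev
  refine le_of_mul_le_mul_right ?_ hrn
  calc a n * r n ≤ A * (1 + d) * n := by linarith
    _ ≤ B * r n * n := by gcongr
    _ = B * n * r n := by ring

lemma eventually_mul_le (ha : Monotone a) (ha0 : ∀ n, 0 ≤ a n)
    (hp : ∀ᶠ l in atTop, HasSum (fun n ↦ poissonWeight l n * a n) (p l))
    (hpA : ∀ᶠ l in atTop, A * l ≤ p l) (hC : 0 ≤ C) (haC : ∀ᶠ n : ℕ in atTop, a n ≤ C * n)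
    (hBA : B < A) : ∀ᶠ n : ℕ in atTop, B * n ≤ a n := by
  obtain ⟨d, ⟨hdB, hd1⟩, hd⟩ : ∃ d, (B < A * (1 - d) ∧ d < 1) ∧ 0 < d := by
    have hlim : Tendsto (fun d ↦ A * (1 - d)) (𝓝 0) (𝓝 A) :=
      Continuous.tendsto' (by fun_prop) _ _ (by simp)
    exact ((((hlim.eventually_const_lt hBA).and (eventually_lt_nhds one_pos)).filter_mono
      nhdsWithin_le_nhds).and (self_mem_nhdsWithin (s := Set.Ioi 0))).exists
  have hscale : Tendsto (fun n : ℕ ↦ (1 - d) * (n : ℝ)) atTop atTop :=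
    tendsto_natCast_atTop_atTop.const_mul_atTop (by linarith)
  filter_upwards [hscale.eventually hp, hscale.eventually hpA, eventually_gt_atTop 0,
    eventually_forall_ge_atTop.2 haC,
    (tendsto_const_div_atTop_nhds_zero_nat (C / d ^ 2)).eventually_lt_const
      (sub_pos.2 hdB)] with n hpn hpAn hn haCn hsmall
  have hn' : (0 : ℝ) < n := by exact_mod_cast hn
  have hchebyshev := le_add_div_of_hasSum_poissonWeight ha ha0 hpn hn hC
    (fun k hk ↦ haCn k hk.le) hd hd1.le
  rw [div_lt_iff₀ hn'] at hsmall
  linarith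

lemma eventually_abs_div_sub_le {I E δ : ℝ} (ha : Monotone a) (ha0 : ∀ n, 0 ≤ a n)
    (hp : ∀ᶠ l in atTop, HasSum (fun n ↦ poissonWeight l n * a n) (p l))
    (hpE : ∀ δ > 0, ∀ᶠ l in atTop, |p l / l - I| ≤ E + δ) (hδ : 0 < δ) :
    ∀ᶠ n : ℕ in atTop, |a n / n - I| ≤ E + δ := by
  have hpE' : ∀ᶠ l in atTop, (I - E - δ / 2) * l ≤ p l ∧ p l ≤ (I + E + δ / 2) * l := by
    filter_upwards [hpE (δ / 2) (half_pos hδ), eventually_gt_atTop 0] with l hl hl0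
    rw [← le_div_iff₀ hl0, ← div_le_iff₀ hl0]
    constructor <;> linarith [abs_le.1 hl]
  have hupper : ∀ᶠ n : ℕ in atTop, a n ≤ (I + E + δ) * n :=
    eventually_le_mul ha ha0 hp (hpE'.mono fun _ ↦ And.right) (by linarith)
  have hC : 0 ≤ I + E + δ := by
    obtain ⟨n, hn, hn0⟩ := (hupper.and (eventually_gt_atTop 0)).exists
    exact nonneg_of_mul_nonneg_left ((ha0 n).trans hn) (by exact_mod_cast hn0)
  have hlower : ∀ᶠ n : ℕ in atTop, (I - E - δ) * n ≤ a n :=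
    eventually_mul_le ha ha0 hp (hpE'.mono fun _ ↦ And.left) hC hupper (by linarith)
  filter_upwards [hupper, hlower, eventually_gt_atTop 0] with n hle hge hn
  have hn' : (0 : ℝ) < n := by exact_mod_cast hn
  rw [← div_le_iff₀ hn'] at hle
  rw [← le_div_iff₀ hn'] at hge
  rw [abs_le]
  constructor <;> linarith

end Depoissonization

/-! ### The sketch of a stream in terms of the received hash values -/

/-- The cell content `c` belongs to a cell that has received exactly the values in `S`: the
counter is the maximum of `S` (or `0`), and the bit tells whether the value one below the counter
has been received, where the value `0` of the empty cell counts as received. -/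
def CellRecords (S : Set ℕ) (c : ℕ × Bool) : Prop :=
  (c.1 = 0 ∨ c.1 ∈ S) ∧ (∀ r ∈ S, r ≤ c.1) ∧ (c.2 = true ↔ c.1 ≤ 1 ∨ c.1 - 1 ∈ S)

lemma CellRecords.unique {S : Set ℕ} {c c' : ℕ × Bool} (hc : CellRecords S c)
    (hc' : CellRecords S c') : c = c' := by
  obtain ⟨hmem, hle, hbit⟩ := hc
  obtain ⟨hmem', hle', hbit'⟩ := hc'
  have hcounter : c.1 = c'.1 := by grind
  exact Prod.ext hcounter (Bool.eq_iff_iff.2 (by rw [hbit, hbit', hcounter]))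

lemma CellRecords.cellUpdate {S : Set ℕ} {c : ℕ × Bool} (hc : CellRecords S c) (r : ℕ) :
    CellRecords (S ∪ {r}) (cellUpdate c r) := by
  obtain ⟨k, b⟩ := c
  obtain ⟨hmem, hle, hbit⟩ := hc
  simp only [CellRecords, EHLL.cellUpdate, Set.mem_union, Set.mem_singleton_iff] at *
  split_ifs <;> grind

section Run

variable {m : ℕ} {V : Type*}

lemma run_append_singleton (h : V → Fin m × ℕ) (M : List V) (v : V) :
    run h (M ++ [v]) = insert (run h M) (h v) := by
  simp [run, List.foldl_append]

lemma cellRecords_run (h : V → Fin m × ℕ) (M : List V) (j : Fin m) :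
    CellRecords {r | ∃ v ∈ M, h v = (j, r)} (run h M j) := by
  induction M using List.reverseRecOn with
  | nil => simp [run, initial, CellRecords]
  | append_singleton M v ih =>
    rw [run_append_singleton, insert]
    rcases eq_or_ne j (h v).1 with rfl | hj
    · rw [Function.update_self]
      convert ih.cellUpdate (h v).2 using 1
      ext r
      simp [or_and_right, exists_or, Prod.ext_iff (x := h v), eq_comm, or_comm]
    · rw [Function.update_of_ne hj]
      convert ih using 1
      ext r
      simp [or_and_right, exists_or, Prod.ext_iff (x := h v), hj.symm]

lemma run_eq_iff (h : V → Fin m × ℕ) (M : List V) (s : Sketch m) :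
    run h M = s ↔ ∀ j, CellRecords {r | ∃ v ∈ M, h v = (j, r)} (s j) := by
  refine ⟨?_, fun hs ↦ funext fun j ↦ (cellRecords_run h M j).unique (hs j)⟩
  rintro rfl
  exact cellRecords_run h M

end Run

/-! ### Inclusion–exclusion for the law of the sketch -/

/-- The values that a cell must not have received in the `i`-th of the four events over which the
indicator of a cell content `c` is expanded by inclusion–exclusion: always those above the
counter, and the counter itself and the value below it if the two components of `i` say so. -/
def avoidSet (c : ℕ × Bool) (i : Bool × Bool) : Set ℕ :=
  {r | c.1 < r ∨ (i.1 = true ∧ r = c.1 ∧ c.1 ≠ 0) ∨ (i.2 = true ∧ r + 1 = c.1 ∧ 2 ≤ c.1)}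

/-- The coefficient of the indicator of the event that `avoidSet c i` is avoided in the
inclusion–exclusion formula for the cell content `c`. -/
noncomputable def avoidCoeff (c : ℕ × Bool) (i : Bool × Bool) : ℝ :=
  (if i.1 then -(if c.1 = 0 then 0 else 1) else 1) *
    (if i.2 then (if c.2 then -1 else 1) * (if c.1 ≤ 1 then 0 else 1) else (if c.2 then 1 else 0))

/-- The probability that a geometric variable with parameter `1/2` lies in `avoidSet c i`. -/
noncomputable def avoidMass (c : ℕ × Bool) (i : Bool × Bool) : ℝ :=
  2 ^ (-(c.1 : ℤ)) + (if i.1 ∧ c.1 ≠ 0 then 2 ^ (-(c.1 : ℤ)) else 0)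
    + (if i.2 ∧ 2 ≤ c.1 then 2 ^ (-(c.1 : ℤ) + 1) else 0)

lemma cellLaw_eq_sum (x : ℝ) (c : ℕ × Bool) :
    cellLaw x c = ∑ i, avoidCoeff c i * exp (-(x * avoidMass c i)) := by
  obtain ⟨k, b⟩ := c
  have hexp (a b : ℝ) : exp (-(x * (a + b))) = exp (-(x * a)) * exp (-(x * b)) := by
    rw [← exp_add]
    ring_nf
  simp only [Fintype.sum_prod_type, Fintype.sum_bool, cellLaw, avoidCoeff, avoidMass, hexp]
  rcases Nat.lt_or_ge k 2 with hk | hk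
  · interval_cases k <;> cases b <;> simp <;> ring
  · have hk0 : k ≠ 0 := by omega
    have hk1 : ¬ k ≤ 1 := by omega
    cases b <;> simp [hk0, hk1, hk] <;> ring

lemma forall_mem_avoidSet_iff (S : Set ℕ) (c : ℕ × Bool) (i : Bool × Bool) :
    (∀ r ∈ avoidSet c i, r ∉ S) ↔ (∀ r, c.1 < r → r ∉ S) ∧
      (i.1 = true → c.1 ≠ 0 → c.1 ∉ S) ∧ (i.2 = true → 2 ≤ c.1 → c.1 - 1 ∉ S) := by
  simp only [avoidSet, Set.mem_ofPred_eq]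
  refine ⟨fun h ↦ ⟨by grind, by grind, fun hi hc ↦ h (c.1 - 1) (by grind)⟩, ?_⟩
  rintro ⟨habove, hcounter, hbelow⟩ r (hr | hr | ⟨hi, hr, hc⟩)
  · exact habove r hr
  · grind
  · rw [Nat.eq_sub_of_add_eq hr]
    exact hbelow hi hc

lemma cellRecords_iff (S : Set ℕ) (c : ℕ × Bool) :
    CellRecords S c ↔ (∀ r, c.1 < r → r ∉ S) ∧ (c.1 = 0 ∨ c.1 ∈ S) ∧
      (c.2 = true ↔ c.1 ≤ 1 ∨ c.1 - 1 ∈ S) := by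
  grind [CellRecords]

open Classical in
lemma ite_cellRecords_eq_sum (S : Set ℕ) (c : ℕ × Bool) :
    (if CellRecords S c then (1 : ℝ) else 0)
      = ∑ i, avoidCoeff c i * (if ∀ r ∈ avoidSet c i, r ∉ S then 1 else 0) := by
  obtain ⟨k, b⟩ := c
  simp only [forall_mem_avoidSet_iff, cellRecords_iff, Fintype.sum_prod_type, Fintype.sum_bool,
    avoidCoeff]
  generalize (∀ r, k < r → r ∉ S) = noneAbove
  by_cases habove : noneAbove
  · rcases Nat.lt_or_ge k 2 with hk | hk
    · interval_cases k
      · cases b <;> simp [habove]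
      · by_cases hS : 1 ∈ S <;> cases b <;> simp [habove, hS]
    · have hk0 : k ≠ 0 := by omega
      have hk1 : ¬ k ≤ 1 := by omega
      by_cases hS : k ∈ S <;> by_cases hS' : k - 1 ∈ S <;> cases b <;>
        simp [habove, hk0, hk1, hS, hS', hk]
  · simp [habove]

/-- The hash values that are avoided in the event chosen by `I`, one event per cell, in the
inclusion–exclusion formula for the sketch `s`. -/
def avoidHash {m : ℕ} (s : Sketch m) (I : Fin m → Bool × Bool) : Set (Fin m × ℕ) :=
  {x | x.2 ∈ avoidSet (s x.1) (I x.1)}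

open Classical in
lemma ite_run_eq_sum {m : ℕ} {V : Type*} (h : V → Fin m × ℕ) (M : List V) (s : Sketch m) :
    (if run h M = s then (1 : ℝ) else 0)
      = ∑ I : Fin m → Bool × Bool, (∏ j, avoidCoeff (s j) (I j)) *
        (if ∀ v ∈ M, h v ∉ avoidHash s I then 1 else 0) := by
  have havoid (I : Fin m → Bool × Bool) : (∀ v ∈ M, h v ∉ avoidHash s I) ↔
      ∀ j, ∀ r ∈ avoidSet (s j) (I j), r ∉ {r | ∃ v ∈ M, h v = (j, r)} := by
    refine ⟨?_, fun H v hv hmem ↦ H (h v).1 _ hmem ⟨v, hv, rfl⟩⟩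
    rintro H j r hr ⟨v, hv, hvr⟩
    exact H v hv (by simpa only [avoidHash, Set.mem_ofPred_eq, hvr] using hr)
  calc (if run h M = s then (1 : ℝ) else 0)
      = ∏ j, if CellRecords {r | ∃ v ∈ M, h v = (j, r)} (s j) then (1 : ℝ) else 0 := by
        simp [Finset.prod_ite_zero, run_eq_iff]
    _ = _ := by
        simp only [ite_cellRecords_eq_sum, Finset.prod_univ_sum, Fintype.piFinset_univ,
          Finset.prod_mul_distrib, Finset.prod_ite_zero, Finset.prod_const_one, havoid,
          Finset.mem_univ, true_implies]

lemma two_zpow_neg (k : ℕ) : (2 : ℝ) ^ (-(k : ℤ)) = (1 / 2) ^ k := by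
  rw [zpow_neg, zpow_natCast, one_div, inv_pow]

lemma hasSum_indicator_Ioi (k : ℕ) :
    HasSum ((Set.Ioi k).indicator fun r : ℕ ↦ (1 / 2 : ℝ) ^ r) ((1 / 2) ^ k) := by
  have htail : HasSum (fun n : ℕ ↦ (1 / 2 : ℝ) ^ (n + (k + 1))) ((1 / 2) ^ k) := by
    have hgeom := hasSum_geometric_two.mul_right ((1 / 2 : ℝ) ^ (k + 1))
    simp only [← pow_add] at hgeom
    rwa [pow_succ', ← mul_assoc, mul_one_div_cancel two_ne_zero, one_mul] at hgeom
  refine (hasSum_nat_add_iff' (k + 1)).1 ?_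
  rw [Finset.sum_eq_zero fun i hi ↦ Set.indicator_of_notMem (by simp at hi ⊢; omega) _, sub_zero]
  exact htail.congr_fun fun n ↦ Set.indicator_of_mem (by simp; omega) _

lemma indicator_avoidSet (g : ℕ → ℝ) (c : ℕ × Bool) (i : Bool × Bool) (r : ℕ) :
    (avoidSet c i).indicator g r = (Set.Ioi c.1).indicator g r
      + (if r = c.1 then (if i.1 ∧ c.1 ≠ 0 then g c.1 else 0) else 0)
      + (if r = c.1 - 1 then (if i.2 ∧ 2 ≤ c.1 then g (c.1 - 1) else 0) else 0) := by
  simp only [Set.indicator_apply, avoidSet, Set.mem_ofPred_eq, Set.mem_Ioi]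
  grind

lemma hasSum_indicator_avoidSet (c : ℕ × Bool) (i : Bool × Bool) :
    HasSum ((avoidSet c i).indicator fun r : ℕ ↦ (1 / 2 : ℝ) ^ r) (avoidMass c i) := by
  have hsum := ((hasSum_indicator_Ioi c.1).add (hasSum_ite_eq c.1
    (if i.1 ∧ c.1 ≠ 0 then (1 / 2 : ℝ) ^ c.1 else 0))).add (hasSum_ite_eq (c.1 - 1)
    (if i.2 ∧ 2 ≤ c.1 then (1 / 2 : ℝ) ^ (c.1 - 1) else 0))
  have hmass : avoidMass c i = (1 / 2) ^ c.1 + (if i.1 ∧ c.1 ≠ 0 then (1 / 2 : ℝ) ^ c.1 else 0)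
      + (if i.2 ∧ 2 ≤ c.1 then (1 / 2 : ℝ) ^ (c.1 - 1) else 0) := by
    have hpred (hc : 2 ≤ c.1) : (2 : ℝ) ^ (-(c.1 : ℤ) + 1) = (1 / 2) ^ (c.1 - 1) := by
      rw [← two_zpow_neg, Nat.cast_sub (by omega)]
      ring_nf
    grind [avoidMass, two_zpow_neg]
  rw [hmass]
  exact hsum.congr_fun fun r ↦ indicator_avoidSet _ c i r

lemma zero_notMem_avoidSet (c : ℕ × Bool) (i : Bool × Bool) : 0 ∉ avoidSet c i := by
  grind [avoidSet]

lemma hasSum_indicator_measureReal_preimage {α β : Type*} [MeasurableSpace α] [MeasurableSpace β]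
    [Countable β] [MeasurableSingletonClass β] (μ : Measure α) [IsFiniteMeasure μ] {g : α → β}
    (hg : Measurable g) (s : Set β) :
    HasSum (s.indicator fun y ↦ μ.real (g ⁻¹' {y})) (μ.real (g ⁻¹' s)) := by
  have htsum := tsum_measure_preimage_singleton (μ := μ) s.to_countable
    fun y _ ↦ hg (measurableSet_singleton y)
  have hsum := ENNReal.hasSum_toReal (htsum.trans_ne (measure_ne_top _ _))
  rw [← ENNReal.tsum_toReal_eq fun _ ↦ measure_ne_top _ _, htsum] at hsum
  exact hasSum_subtype_iff_indicator.1 hsum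

lemma setOf_forall_notMem_avoidHash {m : ℕ} {V Ω : Type*} [DecidableEq V]
    (h : V → Ω → Fin m × ℕ) (M : List V) (s : Sketch m) (I : Fin m → Bool × Bool) :
    {ω | ∀ v ∈ M, h v ω ∉ avoidHash s I} = ⋂ v ∈ M.toFinset, h v ⁻¹' (avoidHash s I)ᶜ := by
  ext ω
  simp

section RandomHash

variable {m : ℕ} {V Ω : Type*} [MeasurableSpace Ω] {P : Measure Ω} {h : V → Ω → Fin m × ℕ}

lemma measurable_run (hh : ∀ v, Measurable (h v)) (M : List V) :
    Measurable fun ω ↦ run (h · ω) M := by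
  induction M using List.reverseRecOn with
  | nil => exact measurable_const
  | append_singleton M v ih =>
    simp only [run_append_singleton]
    exact (Measurable.of_discrete (f := fun p : Sketch m × (Fin m × ℕ) ↦ insert p.1 p.2)).comp
      (ih.prodMk (hh v))

lemma IsRandomHash.measureReal_mem [IsFiniteMeasure P] (hh : IsRandomHash P h) (v : V)
    {U : Fin m → Set ℕ} {q : Fin m → ℝ} (hU : ∀ j, 0 ∉ U j)
    (hq : ∀ j, HasSum ((U j).indicator fun r : ℕ ↦ (1 / 2 : ℝ) ^ r) (q j)) :
    P.real {ω | (h v ω).2 ∈ U (h v ω).1} = 1 / m * ∑ j, q j := by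
  have hsum := hasSum_indicator_measureReal_preimage P (hh.measurable v)
    {x : Fin m × ℕ | x.2 ∈ U x.1}
  have hfiber (j : Fin m) : HasSum (fun r ↦ {x : Fin m × ℕ | x.2 ∈ U x.1}.indicator
      (fun y ↦ P.real (h v ⁻¹' {y})) (j, r)) (1 / m * q j) := by
    refine ((hq j).mul_left (1 / (m : ℝ))).congr_fun fun r ↦ ?_
    by_cases hr : r ∈ U j
    · rw [Set.indicator_of_mem (by exact hr), Set.indicator_of_mem hr]
      exact hh.law v j r (Nat.one_le_iff_ne_zero.2 (by grind))
    · rw [Set.indicator_of_notMem (by exact hr), Set.indicator_of_notMem hr, mul_zero]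
  rw [Finset.mul_sum]
  exact (hsum.prod_fiberwise hfiber).unique (hasSum_fintype _)

lemma IsRandomHash.measureReal_avoidHash [IsFiniteMeasure P] (hh : IsRandomHash P h) (v : V)
    (s : Sketch m) (I : Fin m → Bool × Bool) :
    P.real (h v ⁻¹' avoidHash s I) = 1 / m * ∑ j, avoidMass (s j) (I j) :=
  hh.measureReal_mem v (fun _ ↦ zero_notMem_avoidSet _ _) fun _ ↦ hasSum_indicator_avoidSet _ _

/-- The probability of the sketch `s` after `n` distinct elements, in inclusion–exclusion form. -/
noncomputable def sketchLaw (n : ℕ) (s : Sketch m) : ℝ :=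
  ∑ I : Fin m → Bool × Bool, (∏ j, avoidCoeff (s j) (I j)) *
    (1 - 1 / m * ∑ j, avoidMass (s j) (I j)) ^ n

variable [DecidableEq V] [IsProbabilityMeasure P]

lemma IsRandomHash.measureReal_avoid (hh : IsRandomHash P h) (M : List V) (s : Sketch m)
    (I : Fin m → Bool × Bool) :
    P.real {ω | ∀ v ∈ M, h v ω ∉ avoidHash s I}
      = (1 - 1 / m * ∑ j, avoidMass (s j) (I j)) ^ M.toFinset.card := by
  have hU : MeasurableSet (avoidHash s I) := (Set.to_countable _).measurableSet
  rw [setOf_forall_notMem_avoidHash, measureReal_def, hh.indep.measure_inter_preimage_eq_mul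
    M.toFinset fun _ _ ↦ hU.compl, ENNReal.toReal_prod, ← Finset.prod_const]
  refine Finset.prod_congr rfl fun v _ ↦ ?_
  rw [Set.preimage_compl, ← measureReal_def, probReal_compl_eq_one_sub (hh.measurable v hU),
    hh.measureReal_avoidHash]

lemma IsRandomHash.measureReal_run (hh : IsRandomHash P h) (M : List V) (s : Sketch m) :
    P.real {ω | run (h · ω) M = s} = sketchLaw M.toFinset.card s := by
  classical
  have hrun : MeasurableSet {ω | run (h · ω) M = s} :=
    measurable_run hh.measurable M (measurableSet_singleton s)
  have havoid (I : Fin m → Bool × Bool) : MeasurableSet {ω | ∀ v ∈ M, h v ω ∉ avoidHash s I} := by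
    rw [setOf_forall_notMem_avoidHash]
    exact Finset.measurableSet_biInter _ fun v _ ↦
      hh.measurable v (Set.to_countable _).measurableSet.compl
  have hexpand : {ω | run (h · ω) M = s}.indicator (1 : Ω → ℝ)
      = fun ω ↦ ∑ I : Fin m → Bool × Bool, (∏ j, avoidCoeff (s j) (I j)) *
        {ω | ∀ v ∈ M, h v ω ∉ avoidHash s I}.indicator (1 : Ω → ℝ) ω := by
    ext ω
    simpa only [Set.indicator_apply, Pi.one_apply] using! ite_run_eq_sum (h · ω) M s
  rw [← integral_indicator_one hrun, hexpand, integral_finsetSum]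
  · refine Finset.sum_congr rfl fun I _ ↦ ?_
    rw [integral_const_mul, ← hh.measureReal_avoid M s I, ← integral_indicator_one (havoid I)]
  · exact fun I _ ↦ ((integrable_const 1).indicator (havoid I)).const_mul _

end RandomHash

lemma cellValue_true (k : ℕ) : cellValue (k, true) = (1 / 2) ^ k := by
  simp [cellValue]

lemma cellValue_false (k : ℕ) : cellValue (k, false) = 3 * (1 / 2) ^ k := by
  simp only [cellValue, zpow_add_one₀ (two_ne_zero' ℝ), two_zpow_neg, Bool.toNat_false]
  ring

lemma half_pow_le_cellValue (k : ℕ) (b : Bool) : (1 / 2) ^ k ≤ cellValue (k, b) := by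
  cases b
  · rw [cellValue_false]
    linarith [pow_pos (one_half_pos (α := ℝ)) k]
  · exact (cellValue_true k).ge

lemma cellValue_pos (c : ℕ × Bool) : 0 < cellValue c :=
  (pow_pos one_half_pos c.1).trans_le (half_pow_le_cellValue c.1 c.2)

lemma cellValue_cellUpdate_le (c : ℕ × Bool) (r : ℕ) :
    cellValue (cellUpdate c r) ≤ cellValue c := by
  obtain ⟨k, b⟩ := c
  have hstep {q : ℕ} (hq : k ≤ q) : (1 / 2 : ℝ) ^ q ≤ (1 / 2) ^ k :=
    pow_le_pow_of_le_one (by norm_num) (by norm_num) hq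
  rw [cellUpdate]
  split_ifs with hr hr' hrb
  · rw [cellValue_true]
    exact (hstep (by lia)).trans (half_pow_le_cellValue k b)
  · have hjump : (1 / 2 : ℝ) ^ r ≤ (1 / 2) ^ (k + 2) :=
      pow_le_pow_of_le_one (by norm_num) (by norm_num) (by lia)
    rw [cellValue_false]
    refine le_trans ?_ (half_pow_le_cellValue k b)
    rw [pow_add] at hjump
    linarith [pow_pos (one_half_pos (α := ℝ)) k]
  · rw [cellValue_true]
    exact half_pow_le_cellValue k b
  · exact le_rfl

lemma indicator_eq_inv_sum {m : ℕ} (s : Sketch m) : indicator s = (∑ j, cellValue (s j))⁻¹ := rfl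

lemma sum_cellValue_pos {m : ℕ} [NeZero m] (s : Sketch m) : 0 < ∑ j, cellValue (s j) :=
  Finset.sum_pos (fun _ _ ↦ cellValue_pos _) Finset.univ_nonempty

lemma indicator_nonneg {m : ℕ} (s : Sketch m) : 0 ≤ indicator s :=
  inv_nonneg.2 (Finset.sum_nonneg fun _ _ ↦ (cellValue_pos _).le)

lemma indicator_le_insert {m : ℕ} [NeZero m] (s : Sketch m) (x : Fin m × ℕ) :
    indicator s ≤ indicator (insert s x) := by
  rw [indicator_eq_inv_sum, indicator_eq_inv_sum]
  refine inv_anti₀ (sum_cellValue_pos _) (Finset.sum_le_sum fun j _ ↦ ?_)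
  rw [insert]
  rcases eq_or_ne j x.1 with rfl | hj
  · rw [Function.update_self]
    exact cellValue_cellUpdate_le _ _
  · rw [Function.update_of_ne hj]

/-- The expectation of `indicator` after `n` distinct elements. -/
noncomputable def meanIndicator (m n : ℕ) : ENNReal :=
  ∑' s : Sketch m, ENNReal.ofReal (indicator s) * ENNReal.ofReal (sketchLaw n s)

lemma IsRandomHash.lintegral_indicator_run {m : ℕ} {V Ω : Type*} [DecidableEq V]
    [MeasurableSpace Ω] {P : Measure Ω} [IsProbabilityMeasure P] {h : V → Ω → Fin m × ℕ}
    (hh : IsRandomHash P h) (M : List V) :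
    ∫⁻ ω, ENNReal.ofReal (indicator (run (h · ω) M)) ∂P = meanIndicator m M.toFinset.card := by
  have hrun := measurable_run hh.measurable M
  rw [← lintegral_map (f := fun s : Sketch m ↦ ENNReal.ofReal (indicator s)) .of_discrete hrun,
    lintegral_countable', meanIndicator]
  congr 1 with s
  rw [Measure.map_apply hrun (measurableSet_singleton s), ← hh.measureReal_run M s,
    ofReal_measureReal]
  rfl

section Existence

variable {m : ℕ} [NeZero m]

/-- The law of the hash value of one element: a uniform cell and an independent geometric variable
with values in `{1, 2, …}`. -/
noncomputable def hashLaw (m : ℕ) [NeZero m] : Measure (Fin m × ℕ) :=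
  (PMF.uniformOfFintype (Fin m)).toMeasure.prod
    ((ProbabilityTheory.geometricMeasure ⟨1 / 2, by norm_num, by norm_num⟩).map (· + 1))

instance : IsProbabilityMeasure (hashLaw m) := by
  have := Measure.isProbabilityMeasure_map (μ := ProbabilityTheory.geometricMeasure
    ⟨1 / 2, by norm_num, by norm_num⟩) (measurable_add_const 1).aemeasurable
  rw [hashLaw]
  infer_instance

lemma hashLaw_real_singleton (j : Fin m) {k : ℕ} (hk : 1 ≤ k) :
    (hashLaw m).real {(j, k)} = 1 / m * (1 / 2) ^ k := by
  obtain ⟨k, rfl⟩ := Nat.exists_eq_add_of_le' hk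
  have hpre : (· + 1) ⁻¹' {k + 1} = ({k} : Set ℕ) := by
    ext
    simp
  rw [hashLaw, ← Set.singleton_prod_singleton, measureReal_prod_prod,
    map_measureReal_apply (measurable_add_const 1) (measurableSet_singleton _), hpre,
    ProbabilityTheory.geometricMeasure_real_singleton (by simp [Subtype.ext_iff]), measureReal_def,
    PMF.toMeasure_apply_singleton _ _ (measurableSet_singleton _), PMF.uniformOfFintype_apply]
  norm_num [pow_succ]

lemma exists_isRandomHash (m : ℕ) [NeZero m] :
    ∃ (Ω : Type) (_ : MeasurableSpace Ω) (P : Measure Ω) (h : ℕ → Ω → Fin m × ℕ),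
      IsProbabilityMeasure P ∧ IsRandomHash P h := by
  obtain ⟨Ω, mΩ, P, h, hmeas, hlaw, hindep, hP⟩ :=
    ProbabilityTheory.exists_iid ℕ (hashLaw m)
  refine ⟨Ω, mΩ, P, h, hP, hmeas, hindep, fun v j k hk ↦ ?_⟩
  rw [← hashLaw_real_singleton j hk, ← (hlaw v).map_eq,
    map_measureReal_apply (hmeas v) (measurableSet_singleton _)]
  rfl

lemma sketchLaw_nonneg (n : ℕ) (s : Sketch m) : 0 ≤ sketchLaw n s := by
  obtain ⟨Ω, _, P, h, _, hh⟩ := exists_isRandomHash m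
  have hlaw := hh.measureReal_run (List.range n) s
  rw [List.toFinset_range, Finset.card_range] at hlaw
  exact hlaw ▸ measureReal_nonneg

lemma monotone_meanIndicator : Monotone (meanIndicator m) := by
  obtain ⟨Ω, _, P, h, _, hh⟩ := exists_isRandomHash m
  have hmean (n : ℕ) : meanIndicator m n
      = ∫⁻ ω, ENNReal.ofReal (indicator (run (h · ω) (List.range n))) ∂P := by
    rw [hh.lintegral_indicator_run, List.toFinset_range, Finset.card_range]
  refine monotone_nat_of_le_succ fun n ↦ ?_
  rw [hmean, hmean]
  refine lintegral_mono fun ω ↦ ENNReal.ofReal_le_ofReal ?_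
  rw [List.range_succ, run_append_singleton]
  exact indicator_le_insert _ _

end Existence

/-! ### The mean of the indicator at a Poisson number of elements -/

lemma hasSum_poissonWeight_mul_sketchLaw {m : ℕ} [NeZero m] (x : ℝ) (s : Sketch m) :
    HasSum (fun n ↦ poissonWeight (m * x) n * sketchLaw n s) (∏ j, cellLaw x (s j)) := by
  have hterm (I : Fin m → Bool × Bool) := (hasSum_poissonWeight_mul_pow (m * x)
    (1 - 1 / m * ∑ j, avoidMass (s j) (I j))).mul_left (∏ j, avoidCoeff (s j) (I j))
  have hprod : ∏ j, cellLaw x (s j) = ∑ I : Fin m → Bool × Bool, (∏ j, avoidCoeff (s j) (I j)) *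
      exp (-(m * x * (1 - (1 - 1 / m * ∑ j, avoidMass (s j) (I j))))) := by
    simp only [cellLaw_eq_sum, Finset.prod_univ_sum, Fintype.piFinset_univ,
      Finset.prod_mul_distrib, ← exp_sum, Finset.sum_neg_distrib, ← Finset.mul_sum]
    have hm : (m : ℝ) ≠ 0 := NeZero.ne _
    congr! 4
    field_simp
    ring
  rw [hprod]
  refine (hasSum_sum fun I _ ↦ hterm I).congr_fun fun n ↦ ?_
  rw [sketchLaw, Finset.mul_sum]
  exact Finset.sum_congr rfl fun I _ ↦ mul_left_comm _ _ _

lemma tsum_pi_prod {α : Type*} (g : α → ENNReal) (m : ℕ) :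
    ∑' s : Fin m → α, ∏ j, g (s j) = (∑' c, g c) ^ m := by
  induction m with
  | zero => simp
  | succ m ih =>
    rw [← (Fin.consEquiv fun _ : Fin (m + 1) ↦ α).tsum_eq, ENNReal.tsum_prod']
    simp only [Fin.consEquiv_apply, Fin.prod_univ_succ, Fin.cons_zero, Fin.cons_succ,
      ENNReal.tsum_mul_left, ih, ENNReal.tsum_mul_right, pow_succ']

lemma ofReal_inv_eq_lintegral {a : ℝ} (ha : 0 < a) :
    ENNReal.ofReal a⁻¹ = ∫⁻ t in Set.Ioi (0 : ℝ), ENNReal.ofReal (exp (-(t * a))) := by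
  simp only [mul_comm _ a, ← neg_mul]
  rw [← ofReal_integral_eq_lintegral_ofReal (integrableOn_exp_mul_Ioi (neg_lt_zero.2 ha) 0)
    (.of_forall fun t ↦ (exp_pos _).le), integral_exp_mul_Ioi (neg_lt_zero.2 ha)]
  simp

lemma lintegral_Ioi_comp_mul_left {x : ℝ} (hx : 0 < x) (g : ℝ → ENNReal) :
    ENNReal.ofReal x * ∫⁻ u in Set.Ioi 0, g (x * u) = ∫⁻ t in Set.Ioi 0, g t := by
  have hsubst := lintegral_image_eq_lintegral_abs_deriv_mul (measurableSet_Ioi (a := (0 : ℝ)))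
    (fun u _ ↦ ((hasDerivAt_id u).const_mul x).hasDerivWithinAt)
    (mul_right_injective₀ hx.ne').injOn g
  simp only [id, mul_one, abs_of_pos hx] at hsubst
  rw [← lintegral_const_mul' _ _ ENNReal.ofReal_ne_top, ← hsubst, Set.image_mul_left_Ioi hx,
    mul_zero]

lemma ofReal_indicator_mul_prod_cellLaw {m : ℕ} [NeZero m] {x : ℝ} (hx : 0 ≤ x) (s : Sketch m) :
    ENNReal.ofReal (indicator s) * ENNReal.ofReal (∏ j, cellLaw x (s j))
      = ∫⁻ t in Set.Ioi (0 : ℝ),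
        ∏ j, ENNReal.ofReal (cellLaw x (s j) * exp (-(t * cellValue (s j)))) := by
  rw [indicator_eq_inv_sum, ofReal_inv_eq_lintegral (sum_cellValue_pos s), mul_comm,
    ← lintegral_const_mul' _ _ ENNReal.ofReal_ne_top]
  congr 1 with t
  rw [← ENNReal.ofReal_prod_of_nonneg fun j _ ↦ mul_nonneg (cellLaw_nonneg hx _) (exp_pos _).le,
    ← ENNReal.ofReal_mul (Finset.prod_nonneg fun j _ ↦ cellLaw_nonneg hx _),
    Finset.prod_mul_distrib, ← exp_sum, Finset.sum_neg_distrib, ← Finset.mul_sum]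

lemma tsum_poissonWeight_mul_meanIndicator_eq_tsum {m : ℕ} [NeZero m] {x : ℝ} (hx : 0 ≤ x) :
    ∑' n, ENNReal.ofReal (poissonWeight (m * x) n) * meanIndicator m n
      = ∑' s : Sketch m, ENNReal.ofReal (indicator s) *
        ENNReal.ofReal (∏ j, cellLaw x (s j)) := by
  have hw := poissonWeight_nonneg (l := m * x) (by positivity)
  have hlaw (s : Sketch m) : ENNReal.ofReal (∏ j, cellLaw x (s j))
      = ∑' n, ENNReal.ofReal (poissonWeight (m * x) n) * ENNReal.ofReal (sketchLaw n s) := by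
    have hsum := hasSum_poissonWeight_mul_sketchLaw x s
    rw [← hsum.tsum_eq, ENNReal.ofReal_tsum_of_nonneg
      (fun n ↦ mul_nonneg (hw n) (sketchLaw_nonneg n s)) hsum.summable]
    simp only [ENNReal.ofReal_mul (hw _)]
  simp only [hlaw, meanIndicator, ← ENNReal.tsum_mul_left]
  rw [ENNReal.tsum_comm]
  simp only [mul_left_comm]

lemma tsum_poissonWeight_mul_meanIndicator {m : ℕ} [NeZero m] {x : ℝ} (hx : 0 < x) :
    ∑' n, ENNReal.ofReal (poissonWeight (m * x) n) * meanIndicator m n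
      = ENNReal.ofReal x * poissonIntegral m x := by
  calc ∑' n, ENNReal.ofReal (poissonWeight (m * x) n) * meanIndicator m n
      = ∑' s : Sketch m, ∫⁻ t in Set.Ioi (0 : ℝ),
          ∏ j, ENNReal.ofReal (cellLaw x (s j) * exp (-(t * cellValue (s j)))) := by
        simp only [tsum_poissonWeight_mul_meanIndicator_eq_tsum hx.le,
          ofReal_indicator_mul_prod_cellLaw hx.le]
    _ = ∫⁻ t in Set.Ioi (0 : ℝ), cellTransform x t ^ m := by
        rw [← lintegral_tsum fun s ↦ by fun_prop]
        simp only [cellTransform, ← tsum_pi_prod]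
    _ = ENNReal.ofReal x * poissonIntegral m x :=
        (lintegral_Ioi_comp_mul_left hx fun t ↦ cellTransform x t ^ m).symm

lemma tsum_poissonWeight_mul_meanIndicator_ne_top {m : ℕ} (hm : 2 ≤ m) {x : ℝ} (hx : 1 ≤ x) :
    ∑' n, ENNReal.ofReal (poissonWeight (m * x) n) * meanIndicator m n ≠ ⊤ := by
  have : NeZero m := ⟨by omega⟩
  rw [tsum_poissonWeight_mul_meanIndicator (by linarith)]
  exact ENNReal.mul_ne_top ENNReal.ofReal_ne_top (poissonIntegral_ne_top hm hx)

lemma meanIndicator_ne_top {m : ℕ} (hm : 2 ≤ m) (n : ℕ) : meanIndicator m n ≠ ⊤ := by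
  intro htop
  have hterm := ENNReal.ne_top_of_tsum_ne_top
    (tsum_poissonWeight_mul_meanIndicator_ne_top hm le_rfl) n
  rw [htop] at hterm
  refine hterm (ENNReal.mul_top ?_)
  rw [ne_eq, ENNReal.ofReal_eq_zero, not_le, poissonWeight]
  positivity

lemma hasSum_poissonWeight_mul_meanIndicator {m : ℕ} (hm : 2 ≤ m) {x : ℝ} (hx : 1 ≤ x) :
    HasSum (fun n ↦ poissonWeight (m * x) n * (meanIndicator m n).toReal)
      (x * (poissonIntegral m x).toReal) := by
  have : NeZero m := ⟨by omega⟩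
  have hx0 : 0 < x := by linarith
  have hw := poissonWeight_nonneg (l := m * x) (by positivity)
  have hne := tsum_poissonWeight_mul_meanIndicator_ne_top hm hx
  have hsum := ENNReal.hasSum_toReal hne
  rw [← ENNReal.tsum_toReal_eq (ENNReal.ne_top_of_tsum_ne_top hne),
    tsum_poissonWeight_mul_meanIndicator hx0] at hsum
  simpa [ENNReal.toReal_ofReal, hw, hx0.le] using hsum

lemma eventually_abs_meanIndicator_sub_le {m : ℕ} (hm : 2 ≤ m) {δ : ℝ} (hδ : 0 < δ) :
    ∀ᶠ n : ℕ in atTop, |m * (meanIndicator m n).toReal / n - ∫ u in Set.Ioi (0 : ℝ), f u ^ m|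
      ≤ 0.000084 / m + δ := by
  have : NeZero m := ⟨by omega⟩
  have hm0 : (0 : ℝ) < m := by positivity
  have hmono : Monotone fun n ↦ m * (meanIndicator m n).toReal := fun a b hab ↦
    mul_le_mul_of_nonneg_left
      (ENNReal.toReal_mono (meanIndicator_ne_top hm b) (monotone_meanIndicator hab)) hm0.le
  have hone {l : ℝ} (hl : m ≤ l) : 1 ≤ l / m := by rwa [le_div_iff₀ hm0, one_mul]
  refine eventually_abs_div_sub_le (p := fun l ↦ l * (poissonIntegral m (l / m)).toReal) hmono
    (fun n ↦ by positivity) ?_ (fun δ hδ ↦ ?_) hδ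
  · filter_upwards [eventually_ge_atTop (m : ℝ)] with l hl
    have hsum := (hasSum_poissonWeight_mul_meanIndicator hm (hone hl)).mul_left (m : ℝ)
    rw [mul_div_cancel₀ _ hm0.ne', ← mul_assoc, mul_div_cancel₀ _ hm0.ne'] at hsum
    exact hsum.congr_fun fun n ↦ mul_left_comm _ _ _
  · have herror : Tendsto (fun l : ℝ ↦ 8 * m * 10 ^ m / (l / m)) atTop (𝓝 0) :=
      tendsto_const_nhds.div_atTop (tendsto_id.atTop_div_const hm0)
    filter_upwards [eventually_ge_atTop (m : ℝ), herror.eventually_lt_const hδ] with l hl hlδ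
    rw [mul_div_cancel_left₀ _ (hm0.trans_le hl).ne']
    linarith [abs_poissonIntegral_sub_le hm (hone hl)]

/-! ### The arrival of a new element -/

lemma run_congr {m : ℕ} {V : Type*} {h h' : V → Fin m × ℕ} {M : List V}
    (hM : ∀ v ∈ M, h v = h' v) : run h M = run h' M :=
  List.foldl_ext _ _ _ fun s v hv ↦ by rw [hM v hv]

lemma cellUpdate_ne_iff {c : ℕ × Bool} (hc : c.2 = false → 2 ≤ c.1) (r : ℕ) :
    cellUpdate c r ≠ c ↔ r ∈ avoidSet c (false, !c.2) := by
  obtain ⟨k, b⟩ := c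
  grind [avoidSet, cellUpdate]

lemma avoidMass_false {c : ℕ × Bool} (hc : c.2 = false → 2 ≤ c.1) :
    avoidMass c (false, !c.2) = cellValue c := by
  obtain ⟨k, _ | _⟩ := c
  · simp [avoidMass, cellValue, hc rfl]
  · simp [avoidMass, cellValue]

lemma insert_ne_iff {m : ℕ} {s : Sketch m} (hs : ∀ j, (s j).2 = false → 2 ≤ (s j).1)
    (x : Fin m × ℕ) : insert s x ≠ s ↔ x ∈ avoidHash s fun j ↦ (false, !(s j).2) := by
  rw [insert, ne_eq, Function.update_eq_self_iff]
  exact cellUpdate_ne_iff (hs x.1) x.2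

lemma CellRecords.two_le {S : Set ℕ} {c : ℕ × Bool} (hc : CellRecords S c) (hbit : c.2 = false) :
    2 ≤ c.1 := by
  grind [CellRecords]

section NewElement

variable {m : ℕ} {V Ω : Type*} [MeasurableSpace Ω] {P : Measure Ω} {h : V → Ω → Fin m × ℕ}

open ProbabilityTheory in
lemma IsRandomHash.indepFun_run (hh : IsRandomHash P h) {M : List V} {v : V} (hv : v ∉ M) :
    IndepFun (fun ω ↦ run (h · ω) M) (h v) P := by
  classical
  obtain _ | ⟨⟨ω₀⟩⟩ := isEmpty_or_nonempty Ω
  · simp [IndepFun_iff, Set.eq_empty_of_isEmpty]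
  have hrun : (fun ω ↦ run (h · ω) M) = (fun t : M.toFinset → Fin m × ℕ ↦
      run (fun w ↦ if hw : w ∈ M.toFinset then t ⟨w, hw⟩ else h v ω₀) M) ∘
        fun ω (w : M.toFinset) ↦ h w ω :=
    funext fun ω ↦ run_congr fun w hw ↦ by simp [hw]
  rw [hrun]
  exact (hh.indep.indepFun_finset M.toFinset {v} (by simpa using hv) hh.measurable).comp
    (ψ := fun t : ({v} : Finset V) → Fin m × ℕ ↦ t ⟨v, Finset.mem_singleton_self v⟩)
    .of_discrete .of_discrete

lemma IsRandomHash.cond_run_ne [IsProbabilityMeasure P] (hh : IsRandomHash P h) {M : List V}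
    {v : V} (hv : v ∉ M) {s : Sketch m} (hs : P {ω | run (h · ω) M = s} ≠ 0) :
    (ProbabilityTheory.cond P {ω | run (h · ω) M = s}).real
      {ω | run (h · ω) (M ++ [v]) ≠ s} = 1 / (m * indicator s) := by
  obtain ⟨ω₀, rfl⟩ := nonempty_of_measure_ne_zero hs
  set s := run (h · ω₀) M
  have hbit (j : Fin m) : (s j).2 = false → 2 ≤ (s j).1 :=
    (cellRecords_run (h · ω₀) M j).two_le
  have hmeas : MeasurableSet {ω | run (h · ω) M = s} :=
    measurable_run hh.measurable M (measurableSet_singleton s)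
  have hchange : {ω | run (h · ω) M = s} ∩ {ω | run (h · ω) (M ++ [v]) ≠ s}
      = {ω | run (h · ω) M = s} ∩ h v ⁻¹' avoidHash s fun j ↦ (false, !(s j).2) := by
    ext ω
    simp only [Set.mem_inter_iff, Set.mem_ofPred_eq, Set.mem_preimage, run_append_singleton]
    refine and_congr_right fun hrun ↦ ?_
    rw [hrun, insert_ne_iff hbit]
  have hindep := (hh.indepFun_run hv).measure_inter_preimage_eq_mul {s}
    (avoidHash s fun j ↦ (false, !(s j).2)) (measurableSet_singleton s)
    (Set.to_countable _).measurableSet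
  have hcond : ProbabilityTheory.cond P {ω | run (h · ω) M = s}
      {ω | run (h · ω) (M ++ [v]) ≠ s} = P (h v ⁻¹' avoidHash s fun j ↦ (false, !(s j).2)) := by
    rw [ProbabilityTheory.cond_apply hmeas, hchange]
    refine (congrArg _ hindep).trans ?_
    exact ENNReal.inv_mul_cancel_left hs (measure_ne_top _ _)
  rw [measureReal_def, hcond, ← measureReal_def, hh.measureReal_avoidHash]
  simp only [avoidMass_false (hbit _), indicator_eq_inv_sum]
  field_simp

end NewElement

/-! ### The expectation of the indicator -/

lemma exists_bounded_add_tendsto_zero {α : Type*} {l : Filter α} {r : α → ℝ} {E : ℝ} (hE : 0 ≤ E)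
    (hr : ∀ δ > 0, ∀ᶠ n in l, |r n| ≤ E + δ) :
    ∃ ε δ : α → ℝ, (∀ n, |ε n| ≤ E) ∧ Tendsto δ l (𝓝 0) ∧ ∀ n, r n = ε n + δ n := by
  refine ⟨fun n ↦ max (-E) (min E (r n)), fun n ↦ r n - max (-E) (min E (r n)), fun n ↦ ?_, ?_,
    fun n ↦ (add_sub_cancel _ _).symm⟩
  · exact abs_le.2 ⟨le_max_left _ _, max_le (by linarith) (min_le_left _ _)⟩
  · refine Metric.tendsto_nhds.2 fun δ hδ ↦ ?_
    filter_upwards [hr (δ / 2) (half_pos hδ)] with n hn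
    rw [dist_zero_right, norm_eq_abs, abs_lt]
    grind

lemma exists_meanIndicator_eq {m : ℕ} (hm : 2 ≤ m) :
    ∃ ε δ : ℕ → ℝ, (∀ n, |ε n| ≤ 0.000084) ∧ Tendsto δ atTop (𝓝 0) ∧ ∀ n : ℕ, 1 ≤ n →
      (meanIndicator m n).toReal
        = n / m * ((∫ u in Set.Ioi (0 : ℝ), f u ^ m) + ε n / m + δ n) := by
  have hm0 : (0 : ℝ) < m := by positivity
  obtain ⟨ε, δ, hε, hδ, hsum⟩ := exists_bounded_add_tendsto_zero (l := atTop) (E := 0.000084)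
    (r := fun n : ℕ ↦ m * (m * (meanIndicator m n).toReal / n - ∫ u in Set.Ioi (0 : ℝ), f u ^ m))
    (by norm_num) fun δ hδ ↦ by
      filter_upwards [eventually_abs_meanIndicator_sub_le hm (div_pos hδ hm0)] with n hn
      rwa [abs_mul, abs_of_pos hm0, ← le_div_iff₀' hm0, add_div]
  refine ⟨ε, fun n ↦ δ n / m, hε, by simpa using hδ.div_const (m : ℝ), fun n hn ↦ ?_⟩
  rw [add_assoc, ← add_div, ← hsum]
  field_simp
  ring

section Expectation

variable {m : ℕ} {V Ω : Type*} [MeasurableSpace Ω] {P : Measure Ω} {h : V → Ω → Fin m × ℕ}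

lemma measurable_indicator_run (hh : ∀ v, Measurable (h v)) (M : List V) :
    Measurable fun ω ↦ indicator (run (h · ω) M) :=
  (Measurable.of_discrete (f := indicator (m := m))).comp (measurable_run hh M)

variable [IsProbabilityMeasure P]

lemma IsRandomHash.integrable_indicator_run (hm : 2 ≤ m) (hh : IsRandomHash P h) (M : List V) :
    Integrable (fun ω ↦ indicator (run (h · ω) M)) P := by
  classical
  refine ⟨(measurable_indicator_run hh.measurable M).aestronglyMeasurable, ?_⟩
  rw [hasFiniteIntegral_iff_ofReal (.of_forall fun ω ↦ indicator_nonneg _),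
    hh.lintegral_indicator_run]
  exact (meanIndicator_ne_top hm _).lt_top

lemma IsRandomHash.integral_indicator_run [DecidableEq V] (hh : IsRandomHash P h) (M : List V) :
    ∫ ω, indicator (run (h · ω) M) ∂P = (meanIndicator m M.toFinset.card).toReal := by
  rw [integral_eq_lintegral_of_nonneg_ae (.of_forall fun ω ↦ indicator_nonneg _)
    (measurable_indicator_run hh.measurable M).aestronglyMeasurable, hh.lintegral_indicator_run]

end Expectation

end EHLL

theorem theorem4p1 (m : ℕ) (hm : 2 ≤ m) :
    IntegrableOn (fun u : ℝ => EHLL.f u ^ m) (Set.Ioi 0) ∧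
    ∃ ε δ : ℕ → ℝ,
      (∀ n, |ε n| ≤ 8.4 * (10 : ℝ) ^ (-5 : ℤ)) ∧
      Filter.Tendsto δ Filter.atTop (nhds 0) ∧
      ∀ (V : Type*) [DecidableEq V] (Ω : Type*) [MeasurableSpace Ω] (P : Measure Ω)
        [IsProbabilityMeasure P] (h : V → Ω → Fin m × ℕ), EHLL.IsRandomHash P h →
        ∀ M : List V,
          -- `1 / (m Y)` is the probability that a new element changes the current sketch `s`
          (∀ v, v ∉ M → ∀ s : EHLL.Sketch m, P {ω | EHLL.run (h · ω) M = s} ≠ 0 →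
            (ProbabilityTheory.cond P {ω | EHLL.run (h · ω) M = s}).real
              {ω | EHLL.run (h · ω) (M ++ [v]) ≠ s} = 1 / (m * EHLL.indicator s)) ∧
          Integrable (fun ω => EHLL.indicator (EHLL.run (h · ω) M)) P ∧
          -- the number `n` of distinct elements of the stream is `M.toFinset.card`
          ∀ n : ℕ, M.toFinset.card = n → 1 ≤ n →
            ∫ ω, EHLL.indicator (EHLL.run (h · ω) M) ∂P =
              (n : ℝ) / m * ((∫ u in Set.Ioi (0 : ℝ), EHLL.f u ^ m) + ε n / m + δ n) := by
  obtain ⟨ε, δ, hε, hδ, hmean⟩ := EHLL.exists_meanIndicator_eq hm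
  have hbound : (0.000084 : ℝ) = 8.4 * 10 ^ (-5 : ℤ) := by norm_num
  refine ⟨EHLL.integrableOn_f_pow hm, ε, δ, hbound ▸ hε, hδ, fun V _ Ω _ P _ h hh M ↦
    ⟨fun v hv s hs ↦ hh.cond_run_ne hv hs, hh.integrable_indicator_run hm M, ?_⟩⟩
  rintro n rfl hn
  rw [hh.integral_indicator_run, hmean _ hn]
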